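/- For a positive integer $n$ let $\mathcal K_n$ be the set of polynomials $p(z)=\sum_{k=0}^n a_k z^k$ with $a_k\in\mathbb C$, $|a_k|=1$ for $0\le k\le n$. For $P_n(z)=\sum_{k=0}^n a_{k,n}z^k\in\mathcal K_n$ let $P_n^*(z)=\sum_{k=0}^n \overline{a_{n-k,n}}\,z^k$ be its conjugate reciprocal polynomial. A sequence $(P_n)_{n\ge 1}$ with $P_n\in\mathcal K_n$ for every $n\geq 1$ is called ultraflat if there are positive numbers $\varepsilon_n\to 0$ such that $$(1-\varepsilon_n)\sqrt{n+1}\le |P_n(e^{it})|\le (1+\varepsilon_n)\sqrt{n+1}\qquad (t\in\mathbb R,\ n\ge 1).$$ **Theorem 2.1.** Let $(P_n)_{n\ge 1}$ be an ultraflat sequence of polynomials $P_n\in\mathcal K_n$ and let $q\in(0,\infty)$. Then $$\frac1{2\pi}\int_0^{2\pi}\left|(P_n-P_n^*)(e^{it})\right|^q\,dt\ \sim\ \frac{2^q\,\Gamma\left(\frac{q+1}2\right)}{\Gamma\left(\frac q2+1\right)\sqrt{\pi}}\;n^{q/2},$$ where $\Gamma$ is the gamma function and $\sim$ means that the ratio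 of the left-hand side to the right-hand side converges to $1$ as $n\to\infty$. -/

import Mathlib

namespace Ultraflat

noncomputable section

/-- The class `K_n` of (complex) unimodular polynomials of degree `n`:
polynomials `∑_{k=0}^n a_k z^k` with complex coefficients of modulus one. -/
def unimodular (n : ℕ) : Set (Polynomial ℂ) :=
  {p | ∃ a : ℕ → ℂ, (∀ k ≤ n, ‖a k‖ = 1) ∧
    p = ∑ k ∈ Finset.range (n + 1), Polynomial.C (a k) * Polynomial.X ^ k}

/-- The value `p(e^{it})`. -/
def circleEval (p : Polynomial ℂ) (t : ℝ) : ℂ :=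
  p.eval (Complex.exp (t * Complex.I))

/-- `p` belongs to `K_n` and is `ε`-flat. -/
def IsFlat (n : ℕ) (ε : ℝ) (p : Polynomial ℂ) : Prop :=
  p ∈ unimodular n ∧
    ∀ t : ℝ, (1 - ε) * Real.sqrt ((n : ℝ) + 1) ≤ ‖circleEval p t‖ ∧
      ‖circleEval p t‖ ≤ (1 + ε) * Real.sqrt ((n : ℝ) + 1)

/-- `(P_n)`, `n = 1, 2, 3, …`, is an ultraflat sequence of polynomials `P_n ∈ K_n`: there are
positive numbers `ε_n` tending to `0` such that each `P_n` is `ε_n`-flat.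
The value of `P` at the index `0` plays no role. -/
def IsUltraflat (P : ℕ → Polynomial ℂ) : Prop :=
  ∃ ε : ℕ → ℝ, (∀ n, 1 ≤ n → 0 < ε n) ∧ Filter.Tendsto ε Filter.atTop (nhds 0) ∧
    ∀ n, 1 ≤ n → IsFlat n (ε n) (P n)

/-- The conjugate reciprocal polynomial `∑_{k=0}^n conj(a_{n-k}) z^k` of
`p = ∑_{k=0}^n a_k z^k`. -/
def conjReciprocal (n : ℕ) (p : Polynomial ℂ) : Polynomial ℂ :=
  ∑ k ∈ Finset.range (n + 1),
    Polynomial.C ((starRingEnd ℂ) (p.coeff (n - k))) * Polynomial.X ^ k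

end

end Ultraflat

namespace Ultraflat

open Filter Topology Complex Polynomial MeasureTheory ComplexConjugate

/-! Put f(s) = P_n(e^{is/n})/√(n+1) and let f* be its Schwarz reflection. Flatness on the circle,
carried off it by the maximum principle, makes f bounded and f f* − 1 small on every horizontal
strip, so f is eventually zero-free there. Let λ = −i f'/f be the angular speed. On a disc of radius
R a branch of log f is O(R), so its second derivative at the centre is O(1/R); as R is arbitrary, λ'
→ 0 (`IsUltraflat.isStripSmall_deriv_angularSpeed`). Hence (−i d/ds)^m f ≈ λ^m f. Pairing with f*
and using |a_k| = 1 in Parseval's identity, the mean of λ^m tends to 1/(m+1): the angular speed is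
equidistributed on [0, 1].

Let W = e^{−is} f², so that W' = 2i(λ − 1/2)W. Away from λ = 1/2 the function W^k oscillates and
integration by parts kills its mean; equidistribution of λ makes the remaining set negligible
(`IsUltraflat.tendsto_integral_centeredSq_pow`). Since |W| ≈ 1, Weyl's criterion makes arg W
equidistributed modulo 2π. On the circle |P_n − P_n*| = 2√(n+1) |f| |sin(arg W / 2)| with |f| ≈ 1,
so the q-th mean is governed by the mean of |sin|^q, a quotient of Gamma values. -/

/-! ### Polynomials off the unit circle and the conjugate reciprocal -/

/-- A polynomial of degree at most `d` bounded by `M` on the unit circle grows at most like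
`M * max 1 ‖z‖ ^ d`. -/
theorem norm_eval_le_mul_max_pow {Q : ℂ[X]} {d : ℕ} (hd : Q.natDegree ≤ d) {M : ℝ}
    (hM : ∀ z : ℂ, ‖z‖ = 1 → ‖Q.eval z‖ ≤ M) (z : ℂ) :
    ‖Q.eval z‖ ≤ M * max 1 ‖z‖ ^ d := by
  have disc : ∀ R : ℂ[X], (∀ z : ℂ, ‖z‖ = 1 → ‖R.eval z‖ ≤ M) →
      ∀ z : ℂ, ‖z‖ ≤ 1 → ‖R.eval z‖ ≤ M := by
    intro R hR z hz
    refine Complex.norm_le_of_forall_mem_frontier_norm_le (U := Metric.ball (0 : ℂ) 1)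
      (f := fun z => R.eval z) Metric.isBounded_ball R.differentiable.diffContOnCl ?_ ?_
    · intro w hw
      rw [frontier_ball _ one_ne_zero] at hw
      exact hR w (by simpa using hw)
    · rw [closure_ball _ one_ne_zero]
      simpa using hz
  rcases le_or_gt ‖z‖ 1 with h | h
  · simpa [max_eq_left h] using disc Q hM z h
  · have hz : z ≠ 0 := norm_pos_iff.mp (one_pos.trans h)
    have key : ∀ w : ℂ, w ≠ 0 → (Q.reflect d).eval w⁻¹ * w ^ d = Q.eval w := by
      intro w hw
      let := invertibleOfNonzero hw
      have h1 := eval₂_reflect_mul_pow (RingHom.id ℂ) w d Q hd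
      rwa [invOf_eq_inv] at h1
    have hrefl : ∀ w : ℂ, ‖w‖ = 1 → ‖(Q.reflect d).eval w‖ ≤ M := by
      intro w hw
      have hw0 : w ≠ 0 := norm_ne_zero_iff.mp (by rw [hw]; exact one_ne_zero)
      have h1 := hM w⁻¹ (by rw [norm_inv, hw, inv_one])
      rwa [← key w⁻¹ (inv_ne_zero hw0), inv_inv, norm_mul, norm_pow, norm_inv, hw, inv_one,
        one_pow, mul_one] at h1
    rw [← key z hz, norm_mul, norm_pow, max_eq_right h.le]
    gcongr
    exact disc _ hrefl _ (by rw [norm_inv]; exact inv_le_one_of_one_le₀ h.le)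

/-- Stated for all z ≠ 0, not only on the circle, because the product p p* is later evaluated at the
points e^{is/n} with s in a strip. -/
theorem conjReciprocal_eval (n : ℕ) {p : ℂ[X]} (hp : p.natDegree ≤ n) {z : ℂ} (hz : z ≠ 0) :
    (conjReciprocal n p).eval z = z ^ n * conj (p.eval (conj z)⁻¹) := by
  have h := p.eval_eq_sum_range' (Nat.lt_succ_of_le hp) (conj z)⁻¹
  rw [h, conjReciprocal, eval_finsetSum, map_sum, Finset.mul_sum, ← Finset.sum_range_reflect]
  refine Finset.sum_congr rfl fun k hk => ?_
  have hk' : k ≤ n := Nat.lt_succ_iff.mp (Finset.mem_range.mp hk)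
  have e : n + 1 - 1 - k = n - k := by omega
  have e' : n - (n - k) = k := by omega
  obtain ⟨j, rfl⟩ := Nat.exists_eq_add_of_le hk'
  simp only [e, e', eval_mul, eval_C, eval_pow, eval_X, map_mul, map_pow, map_inv₀, conj_conj]
  rw [Nat.add_sub_cancel_left, pow_add, inv_pow]
  field_simp

theorem natDegree_conjReciprocal_le (n : ℕ) (p : ℂ[X]) :
    (conjReciprocal n p).natDegree ≤ n := by
  refine natDegree_sum_le_of_forall_le _ _ fun k hk => ?_
  exact (natDegree_C_mul_X_pow_le _ _).trans (Nat.lt_succ_iff.mp (Finset.mem_range.mp hk))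

theorem unimodular.natDegree_le {n : ℕ} {p : ℂ[X]} (hp : p ∈ unimodular n) :
    p.natDegree ≤ n := by
  obtain ⟨a, -, rfl⟩ := hp
  refine natDegree_sum_le_of_forall_le _ _ fun k hk => ?_
  exact (natDegree_C_mul_X_pow_le _ _).trans (Nat.lt_succ_iff.mp (Finset.mem_range.mp hk))

theorem unimodular.norm_coeff {n : ℕ} {p : ℂ[X]} (hp : p ∈ unimodular n) {k : ℕ} (hk : k ≤ n) :
    ‖p.coeff k‖ = 1 := by
  obtain ⟨a, ha, rfl⟩ := hp
  have : (∑ k ∈ Finset.range (n + 1), C (a k) * X ^ k).coeff k = a k := by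
    simp [coeff_C_mul, coeff_X_pow, Finset.sum_ite_eq, hk]
  rw [this, ha k hk]

/-! ### Calculus of sequences bounded or small on horizontal strips -/

variable {h h' : ℕ → ℂ → ℂ}

/-- The open horizontal strip of half-width `K` around the real axis. -/
def strip (K : ℝ) : Set ℂ := {s | |s.im| < K}

theorem isOpen_strip (K : ℝ) : IsOpen (strip K) :=
  isOpen_lt (by fun_prop) continuous_const

theorem closedBall_subset_strip {K R : ℝ} {s : ℂ} (hs : s ∈ strip K) :
    Metric.closedBall s R ⊆ strip (K + R) := by
  intro w hw
  have h1 : ‖w - s‖ ≤ R := by simpa [dist_eq_norm] using hw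
  have h2 := (abs_im_le_norm (w - s)).trans h1
  have h3 : |w.im| ≤ |s.im| + |(w - s).im| := by
    simpa using abs_add_le s.im (w - s).im
  have h4 : |s.im| < K := hs
  change |w.im| < K + R
  linarith

theorem ofReal_mem_strip (x : ℝ) {K : ℝ} (hK : 0 < K) : (x : ℂ) ∈ strip K := by
  simpa [strip] using hK

/-- A sequence of functions is eventually holomorphic and uniformly bounded on every strip. -/
def IsStripBounded (h : ℕ → ℂ → ℂ) : Prop :=
  ∀ K : ℝ, ∃ M : ℝ, ∀ᶠ n in atTop, DifferentiableOn ℂ (h n) (strip K) ∧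
    ∀ s ∈ strip K, ‖h n s‖ ≤ M

/-- A sequence of functions is eventually holomorphic and tends to zero uniformly on every
strip. -/
def IsStripSmall (h : ℕ → ℂ → ℂ) : Prop :=
  ∀ K c : ℝ, 0 < c → ∀ᶠ n in atTop, DifferentiableOn ℂ (h n) (strip K) ∧
    ∀ s ∈ strip K, ‖h n s‖ ≤ c

theorem IsStripSmall.isStripBounded (hh : IsStripSmall h) : IsStripBounded h :=
  fun K => ⟨1, hh K 1 one_pos⟩

theorem IsStripSmall.congr (hh : IsStripSmall h)
    (e : ∀ K, ∀ᶠ n in atTop, Set.EqOn (h' n) (h n) (strip K)) : IsStripSmall h' := by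
  intro K c hc
  filter_upwards [hh K c hc, e K] with n hn en
  exact ⟨hn.1.congr en, fun s hs => by rw [en hs]; exact hn.2 s hs⟩

theorem IsStripBounded.congr (hh : IsStripBounded h)
    (e : ∀ K, ∀ᶠ n in atTop, Set.EqOn (h' n) (h n) (strip K)) : IsStripBounded h' := by
  intro K
  obtain ⟨M, hM⟩ := hh K
  refine ⟨M, ?_⟩
  filter_upwards [hM, e K] with n hn en
  exact ⟨hn.1.congr en, fun s hs => by rw [en hs]; exact hn.2 s hs⟩

theorem IsStripSmall.add (hh : IsStripSmall h) (hh' : IsStripSmall h') :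
    IsStripSmall fun n s => h n s + h' n s := by
  intro K c hc
  filter_upwards [hh K (c / 2) (half_pos hc), hh' K (c / 2) (half_pos hc)] with n hn hn'
  refine ⟨hn.1.add hn'.1, fun s hs => (norm_add_le _ _).trans ?_⟩
  linarith [hn.2 s hs, hn'.2 s hs]

theorem isStripBounded_const (a : ℂ) : IsStripBounded fun _ _ => a :=
  fun _ => ⟨‖a‖, Eventually.of_forall fun _ => ⟨differentiableOn_const _, fun _ _ => le_rfl⟩⟩

theorem isStripSmall_zero : IsStripSmall fun _ _ => 0 :=
  fun _ _ hc => Eventually.of_forall fun _ => ⟨differentiableOn_const _, fun _ _ => by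
    simpa using hc.le⟩

theorem IsStripBounded.add (hh : IsStripBounded h) (hh' : IsStripBounded h') :
    IsStripBounded fun n s => h n s + h' n s := by
  intro K
  obtain ⟨M, hM⟩ := hh K
  obtain ⟨M', hM'⟩ := hh' K
  refine ⟨M + M', ?_⟩
  filter_upwards [hM, hM'] with n hn hn'
  exact ⟨hn.1.add hn'.1, fun s hs => (norm_add_le _ _).trans (add_le_add (hn.2 s hs) (hn'.2 s hs))⟩

theorem IsStripBounded.mul (hh : IsStripBounded h) (hh' : IsStripBounded h') :
    IsStripBounded fun n s => h n s * h' n s := by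
  intro K
  obtain ⟨M, hM⟩ := hh K
  obtain ⟨M', hM'⟩ := hh' K
  refine ⟨|M| * |M'|, ?_⟩
  filter_upwards [hM, hM'] with n hn hn'
  refine ⟨hn.1.mul hn'.1, fun s hs => ?_⟩
  rw [norm_mul]
  exact mul_le_mul ((hn.2 s hs).trans (le_abs_self _)) ((hn'.2 s hs).trans (le_abs_self _))
    (norm_nonneg _) (abs_nonneg _)

theorem IsStripSmall.mul_bounded (hh : IsStripSmall h) (hh' : IsStripBounded h') :
    IsStripSmall fun n s => h n s * h' n s := by
  intro K c hc
  obtain ⟨M', hM'⟩ := hh' K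
  filter_upwards [hh K (c / (|M'| + 1)) (by positivity), hM'] with n hn hn'
  refine ⟨hn.1.mul hn'.1, fun s hs => ?_⟩
  rw [norm_mul]
  calc ‖h n s‖ * ‖h' n s‖ ≤ c / (|M'| + 1) * (|M'| + 1) := by
        gcongr
        · exact hn.2 s hs
        · linarith [hn'.2 s hs, le_abs_self M']
    _ = c := by field_simp

theorem IsStripBounded.mul_small (hh : IsStripBounded h) (hh' : IsStripSmall h') :
    IsStripSmall fun n s => h n s * h' n s :=
  (hh'.mul_bounded hh).congr fun _ => Eventually.of_forall fun _ _ _ => mul_comm _ _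

theorem IsStripSmall.const_mul (hh : IsStripSmall h) (a : ℂ) :
    IsStripSmall fun n s => a * h n s :=
  (isStripBounded_const a).mul_small hh

theorem IsStripBounded.const_mul (hh : IsStripBounded h) (a : ℂ) :
    IsStripBounded fun n s => a * h n s :=
  (isStripBounded_const a).mul hh

theorem IsStripSmall.sub (hh : IsStripSmall h) (hh' : IsStripSmall h') :
    IsStripSmall fun n s => h n s - h' n s :=
  (hh.add (hh'.const_mul (-1))).congr fun _ => Eventually.of_forall fun _ _ _ => by ring

theorem IsStripBounded.pow (hh : IsStripBounded h) (m : ℕ) :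
    IsStripBounded fun n s => h n s ^ m := by
  induction m with
  | zero => simpa using isStripBounded_const 1
  | succ m ih => simpa [pow_succ] using ih.mul hh

theorem IsStripBounded.eval (hh : IsStripBounded h) (p : ℂ[X]) :
    IsStripBounded fun n s => p.eval (h n s) := by
  induction p using Polynomial.induction_on' with
  | add p r hp hr => simpa using hp.add hr
  | monomial m a => simpa using (hh.pow m).const_mul a

theorem IsStripSmall.pow_sub_pow (hd : IsStripSmall fun n s => h n s - h' n s)
    (hh : IsStripBounded h) (hh' : IsStripBounded h') (m : ℕ) :
    IsStripSmall fun n s => h n s ^ m - h' n s ^ m := by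
  induction m with
  | zero => simpa using isStripSmall_zero
  | succ m ih =>
    refine ((ih.mul_bounded hh).add ((hh'.pow m).mul_small hd)).congr
      fun _ => Eventually.of_forall fun _ _ _ => ?_
    ring

theorem IsStripSmall.eval_sub_eval (hd : IsStripSmall fun n s => h n s - h' n s)
    (hh : IsStripBounded h) (hh' : IsStripBounded h') (p : ℂ[X]) :
    IsStripSmall fun n s => p.eval (h n s) - p.eval (h' n s) := by
  induction p using Polynomial.induction_on' with
  | add p r hp hr =>
    refine (hp.add hr).congr fun _ => Eventually.of_forall fun _ _ _ => ?_
    simp only [eval_add]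
    ring
  | monomial m a =>
    refine ((hd.pow_sub_pow hh hh' m).const_mul a).congr
      fun _ => Eventually.of_forall fun _ _ _ => ?_
    simp only [eval_monomial]
    ring

/-- Cauchy's estimate on a disc of radius one. The lost unit of half-width is harmless, since the
strip conditions are imposed for every half-width. -/
theorem norm_deriv_le_of_strip {g : ℂ → ℂ} {K M : ℝ}
    (hg : DifferentiableOn ℂ g (strip (K + 1))) (hM : ∀ s ∈ strip (K + 1), ‖g s‖ ≤ M) {s : ℂ}
    (hs : s ∈ strip K) : ‖deriv g s‖ ≤ M := by
  have hsub := closedBall_subset_strip (R := 1) hs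
  simpa using norm_deriv_le_of_forall_mem_sphere_norm_le one_pos (hg.diffContOnCl_ball hsub)
    fun z hz => hM z (hsub (Metric.sphere_subset_closedBall hz))

theorem strip_mono {K K' : ℝ} (hK : K ≤ K') : strip K ⊆ strip K' :=
  fun s (hs : |s.im| < K) => hs.trans_le hK

theorem differentiableOn_deriv_strip {g : ℂ → ℂ} {K : ℝ} (hg : DifferentiableOn ℂ g (strip K)) :
    DifferentiableOn ℂ (deriv g) (strip K) :=
  hg.deriv (isOpen_strip K)

theorem IsStripBounded.deriv (hh : IsStripBounded h) : IsStripBounded fun n => deriv (h n) := by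
  intro K
  obtain ⟨M, hM⟩ := hh (K + 1)
  refine ⟨M, hM.mono fun n hn => ⟨?_, fun s hs => norm_deriv_le_of_strip hn.1 hn.2 hs⟩⟩
  exact (differentiableOn_deriv_strip hn.1).mono (strip_mono (by linarith))

theorem IsStripSmall.deriv (hh : IsStripSmall h) : IsStripSmall fun n => deriv (h n) := by
  intro K c hc
  refine (hh (K + 1) c hc).mono fun n hn => ⟨?_, fun s hs => norm_deriv_le_of_strip hn.1 hn.2 hs⟩
  exact (differentiableOn_deriv_strip hn.1).mono (strip_mono (by linarith))

theorem IsStripBounded.eventually_differentiableOn (hh : IsStripBounded h) (K : ℝ) :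
    ∀ᶠ n in atTop, DifferentiableOn ℂ (h n) (strip K) := by
  obtain ⟨M, hM⟩ := hh K
  exact hM.mono fun n hn => hn.1

/-- The restriction to the real axis, on the scale where the angular variable is `t = s / n`. -/
theorem continuous_comp_mul_ofReal {g : ℂ → ℂ} (hg : DifferentiableOn ℂ g (strip 1)) (n : ℕ) :
    Continuous fun t : ℝ => g ((n : ℂ) * t) := by
  refine hg.continuousOn.comp_continuous (by fun_prop) fun t => ?_
  exact_mod_cast ofReal_mem_strip ((n : ℝ) * t) one_pos

theorem IsStripBounded.eventually_continuous (hh : IsStripBounded h) :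
    ∀ᶠ n in atTop, Continuous fun t : ℝ => h n ((n : ℂ) * t) :=
  (hh.eventually_differentiableOn 1).mono fun n hn => continuous_comp_mul_ofReal hn n

theorem natCast_mul_ofReal_mem_strip (n : ℕ) (t : ℝ) : (n : ℂ) * t ∈ strip 1 := by
  exact_mod_cast ofReal_mem_strip ((n : ℝ) * t) one_pos

theorem IsStripSmall.tendsto_integral (hh : IsStripSmall h) :
    Tendsto (fun n : ℕ => ∫ t in (0 : ℝ)..2 * Real.pi, h n ((n : ℂ) * t)) atTop (𝓝 0) := by
  rw [Metric.tendsto_nhds]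
  intro c hc
  have hpi := Real.pi_pos
  filter_upwards [hh 1 (c / (4 * Real.pi)) (by positivity)] with n hn
  rw [dist_zero_right]
  refine (intervalIntegral.norm_integral_le_of_norm_le_const
    (C := c / (4 * Real.pi)) fun t _ => hn.2 _ (natCast_mul_ofReal_mem_strip n t)).trans_lt ?_
  rw [sub_zero, abs_of_pos (by positivity)]
  field_simp
  linarith

theorem IsStripSmall.tendsto_integral_of_sub (hd : IsStripSmall fun n s => h n s - h' n s)
    (hh : IsStripBounded h') {a : ℂ}
    (ha : Tendsto (fun n : ℕ => ∫ t in (0 : ℝ)..2 * Real.pi, h' n ((n : ℂ) * t)) atTop (𝓝 a)) :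
    Tendsto (fun n : ℕ => ∫ t in (0 : ℝ)..2 * Real.pi, h n ((n : ℂ) * t)) atTop (𝓝 a) := by
  have := hd.tendsto_integral.add ha
  rw [zero_add] at this
  refine this.congr' ?_
  filter_upwards [hh.eventually_continuous, hd.isStripBounded.eventually_continuous] with n h1 h2
  rw [← intervalIntegral.integral_add (h2.intervalIntegrable _ _) (h1.intervalIntegrable _ _)]
  simp

/-! ### The rescaled polynomial and its reflection -/

variable {P : ℕ → ℂ[X]}

/-- The values of `p` along the unit circle, normalized in modulus and rescaled so that the
frequencies lie in `[0, 1]`, as an entire function. -/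
noncomputable def scaled (n : ℕ) (p : ℂ[X]) (s : ℂ) : ℂ :=
  p.eval (exp (s * I / n)) / (Real.sqrt ((n : ℝ) + 1) : ℂ)

/-- The Schwarz reflection of `scaled n p` in the real axis. -/
noncomputable def scaledConj (n : ℕ) (p : ℂ[X]) (s : ℂ) : ℂ :=
  conj (scaled n p (conj s))

theorem differentiable_scaled (n : ℕ) (p : ℂ[X]) : Differentiable ℂ (scaled n p) := by
  have h : Differentiable ℂ fun s : ℂ => exp (s * I / n) := by fun_prop
  exact (p.differentiable.comp h).div_const _

theorem hasDerivAt_scaledConj (n : ℕ) (p : ℂ[X]) (s : ℂ) :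
    HasDerivAt (scaledConj n p) (conj (deriv (scaled n p) (conj s))) s := by
  have := ((differentiable_scaled n p) (conj s)).hasDerivAt.conj_conj
  rwa [conj_conj] at this

theorem differentiable_scaledConj (n : ℕ) (p : ℂ[X]) : Differentiable ℂ (scaledConj n p) :=
  fun s => (hasDerivAt_scaledConj n p s).differentiableAt

theorem sqrt_succ_sq (n : ℕ) : (Real.sqrt ((n : ℝ) + 1) : ℂ) ^ 2 = (n : ℂ) + 1 := by
  rw [← ofReal_pow, Real.sq_sqrt (by positivity)]
  push_cast
  rfl

theorem IsFlat.norm_eval_le {n : ℕ} {ε : ℝ} {p : ℂ[X]} (hp : IsFlat n ε p) {z : ℂ}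
    (hz : ‖z‖ = 1) :
    (1 - ε) * Real.sqrt ((n : ℝ) + 1) ≤ ‖p.eval z‖ ∧
      ‖p.eval z‖ ≤ (1 + ε) * Real.sqrt ((n : ℝ) + 1) := by
  have h := hp.2 z.arg
  have hz' : exp (z.arg * I) = z := by
    have := norm_mul_exp_arg_mul_I z
    rwa [hz, ofReal_one, one_mul] at this
  rwa [circleEval, hz'] at h

theorem norm_exp_mul_I_div (n : ℕ) (s : ℂ) : ‖exp (s * I / n)‖ = Real.exp (-s.im / n) := by
  rw [norm_exp]
  congr 1
  have : s * I / n = ((n : ℝ)⁻¹ : ℝ) * (s * I) := by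
    push_cast
    ring
  rw [this, re_ofReal_mul]
  simp [div_eq_inv_mul]

theorem max_one_exp_pow {n : ℕ} (hn : 1 ≤ n) (y : ℝ) :
    max 1 (Real.exp (y / n)) ^ n = max 1 (Real.exp y) := by
  have hn0 : (n : ℝ) ≠ 0 := by positivity
  have e : Real.exp (y / n) ^ n = Real.exp y := by
    rw [← Real.exp_nat_mul, mul_div_cancel₀ _ hn0]
  rcases le_total 0 y with hy | hy
  · rw [max_eq_right (Real.one_le_exp (by positivity)), e, max_eq_right (Real.one_le_exp hy)]
  · rw [max_eq_left (Real.exp_le_one_iff.mpr (div_nonpos_of_nonpos_of_nonneg hy (by positivity))),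
      max_eq_left (Real.exp_le_one_iff.mpr hy), one_pow]

/-- Since |e^{is/n}| = e^{−Im s/n}, the n-th power in the growth bound cancels the n in the
exponent, leaving a bound uniform in n. -/
theorem IsFlat.norm_scaled_le {n : ℕ} {ε : ℝ} {p : ℂ[X]} (hp : IsFlat n ε p) (hn : 1 ≤ n)
    (hε : 0 ≤ ε) (s : ℂ) : ‖scaled n p s‖ ≤ (1 + ε) * Real.exp |s.im| := by
  have hs : 0 < Real.sqrt ((n : ℝ) + 1) := by positivity
  have h := norm_eval_le_mul_max_pow (unimodular.natDegree_le hp.1)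
    (fun z hz => (hp.norm_eval_le hz).2) (exp (s * I / n))
  rw [norm_exp_mul_I_div, max_one_exp_pow hn] at h
  have h2 : max 1 (Real.exp (-s.im)) ≤ Real.exp |s.im| :=
    max_le (Real.one_le_exp (abs_nonneg _)) (Real.exp_le_exp.mpr (neg_le_abs _))
  rw [scaled, norm_div, norm_real, Real.norm_of_nonneg hs.le, div_le_iff₀ hs]
  calc _ ≤ _ := h
    _ ≤ (1 + ε) * Real.sqrt ((n : ℝ) + 1) * Real.exp |s.im| := by gcongr
    _ = _ := by ring

theorem IsFlat.norm_scaledConj_le {n : ℕ} {ε : ℝ} {p : ℂ[X]} (hp : IsFlat n ε p) (hn : 1 ≤ n)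
    (hε : 0 ≤ ε) (s : ℂ) : ‖scaledConj n p s‖ ≤ (1 + ε) * Real.exp |s.im| := by
  simpa [scaledConj] using hp.norm_scaled_le hn hε (conj s)

/-- The polynomial Q = p p* − (n+1)zⁿ has degree at most 2n, and on the circle its modulus is | |p|²
− (n+1) |, which flatness makes small. The growth bound carries this smallness to the strip. -/
theorem IsFlat.norm_scaled_mul_scaledConj_sub_one_le {n : ℕ} {ε : ℝ} {p : ℂ[X]}
    (hp : IsFlat n ε p) (hn : 1 ≤ n) (hε : 0 ≤ ε) (hε1 : ε ≤ 1) (s : ℂ) :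
    ‖scaled n p s * scaledConj n p s - 1‖ ≤ 3 * ε * Real.exp |s.im| := by
  have hdeg := unimodular.natDegree_le hp.1
  have hs2 := Real.sq_sqrt (show (0 : ℝ) ≤ (n : ℝ) + 1 by positivity)
  have hn1 : (0 : ℝ) < (n : ℝ) + 1 := by positivity
  have hn0 : (n : ℂ) ≠ 0 := Nat.cast_ne_zero.mpr (by omega)
  set Q : ℂ[X] := p * conjReciprocal n p - C ((n : ℂ) + 1) * X ^ n with hQ
  have hQdeg : Q.natDegree ≤ 2 * n := by
    refine (natDegree_sub_le _ _).trans (max_le ?_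
      ((natDegree_C_mul_X_pow_le _ _).trans (by omega)))
    exact natDegree_mul_le.trans ((add_le_add hdeg (natDegree_conjReciprocal_le n p)).trans
      (two_mul n).ge)
  have hQz : ∀ z : ℂ, z ≠ 0 →
      Q.eval z = z ^ n * (p.eval z * conj (p.eval (conj z)⁻¹) - ((n : ℂ) + 1)) := by
    intro z hz
    simp only [hQ, eval_sub, eval_mul, eval_C, eval_pow, eval_X, conjReciprocal_eval n hdeg hz]
    ring
  -- The constant 3 comes from (1 + ε)² − 1 = 2ε + ε² ≤ 3ε for ε ≤ 1; the same condition keeps 1 − ε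
  -- ≥ 0 when the lower bound is squared.
  have hM : ∀ z : ℂ, ‖z‖ = 1 → ‖Q.eval z‖ ≤ 3 * ε * ((n : ℝ) + 1) := by
    intro z hz
    have hz0 : z ≠ 0 := norm_ne_zero_iff.mp (by rw [hz]; exact one_ne_zero)
    have hzc : (conj z)⁻¹ = z := by
      rw [inv_eq_of_mul_eq_one_right]
      rw [← normSq_eq_conj_mul_self, normSq_eq_norm_sq, hz]
      simp
    obtain ⟨hl, hu⟩ := hp.norm_eval_le hz
    rw [hQz z hz0, hzc, mul_conj, norm_mul, norm_pow, hz, one_pow, one_mul, normSq_eq_norm_sq]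
    have : (((‖p.eval z‖ ^ 2 : ℝ) : ℂ) - ((n : ℂ) + 1))
        = ((‖p.eval z‖ ^ 2 - ((n : ℝ) + 1) : ℝ) : ℂ) := by push_cast; rfl
    rw [this, norm_real, Real.norm_eq_abs, abs_le]
    have hl2 := pow_le_pow_left₀ (mul_nonneg (by linarith) (Real.sqrt_nonneg _)) hl 2
    have hu2 := pow_le_pow_left₀ (norm_nonneg _) hu 2
    rw [mul_pow, hs2] at hl2 hu2
    constructor <;> nlinarith [mul_nonneg hε hn1.le, mul_nonneg (mul_nonneg hε hε) hn1.le,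
      mul_nonneg (mul_nonneg hε (sub_nonneg.mpr hε1)) hn1.le]
  set z := exp (s * I / n) with hz
  have hz0 : z ≠ 0 := exp_ne_zero _
  have hzn : ‖z‖ ^ n = Real.exp (-s.im) := by
    rw [hz, norm_exp_mul_I_div, ← Real.exp_nat_mul, mul_div_cancel₀]
    exact_mod_cast hn0
  have hconj : exp (conj s * I / n) = (conj z)⁻¹ := by
    rw [hz, ← exp_conj, ← exp_neg]
    congr 1
    simp only [map_div₀, map_mul, conj_I, map_natCast]
    ring
  have hmain : scaled n p s * scaledConj n p s - 1 = Q.eval z / (z ^ n * ((n : ℂ) + 1)) := by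
    have hs0 : (Real.sqrt ((n : ℝ) + 1) : ℂ) ≠ 0 := by
      exact_mod_cast (Real.sqrt_pos.mpr hn1).ne'
    have hc : ((n : ℂ) + 1) ≠ 0 := by exact_mod_cast hn1.ne'
    rw [hQz z hz0, scaledConj, scaled, scaled, hconj, ← hz, map_div₀, conj_ofReal,
      div_mul_div_comm, ← sq, sqrt_succ_sq]
    field_simp
  have h := norm_eval_le_mul_max_pow hQdeg hM z
  have hmax : max 1 ‖z‖ ^ (2 * n) = max 1 (Real.exp (-s.im)) ^ 2 := by
    rw [mul_comm 2 n, pow_mul, hz, norm_exp_mul_I_div, max_one_exp_pow hn]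
  -- The factor e^{−Im s} is |zⁿ|, which the denominator of `hmain` cancels.
  have hmax2 : max 1 (Real.exp (-s.im)) ^ 2 ≤ Real.exp |s.im| * Real.exp (-s.im) := by
    rcases le_total 0 s.im with hy | hy
    · rw [max_eq_left (Real.exp_le_one_iff.mpr (by linarith)), abs_of_nonneg hy, ← Real.exp_add]
      simp
    · rw [max_eq_right (Real.one_le_exp (by linarith)), abs_of_nonpos hy, sq]
  have hnorm : ‖(n : ℂ) + 1‖ = (n : ℝ) + 1 := by
    exact_mod_cast Complex.norm_natCast (n + 1)
  rw [hmain, norm_div, norm_mul, norm_pow, hzn, hnorm, div_le_iff₀ (by positivity)]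
  calc _ ≤ _ := h
    _ ≤ 3 * ε * ((n : ℝ) + 1) * (Real.exp |s.im| * Real.exp (-s.im)) := by
        rw [hmax]
        gcongr
    _ = _ := by ring

theorem IsUltraflat.eventually_isFlat {P : ℕ → ℂ[X]} (hP : IsUltraflat P) {c : ℝ} (hc : 0 < c) :
    ∀ᶠ n in atTop, 1 ≤ n ∧ ∃ ε : ℝ, 0 ≤ ε ∧ ε ≤ c ∧ IsFlat n ε (P n) := by
  obtain ⟨ε, hpos, hlim, hflat⟩ := hP
  filter_upwards [eventually_ge_atTop 1, hlim.eventually_le_const hc] with n hn hle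
  exact ⟨hn, ε n, (hpos n hn).le, hle, hflat n hn⟩

theorem IsUltraflat.isStripBounded_scaled (hP : IsUltraflat P) :
    IsStripBounded fun n => scaled n (P n) := by
  intro K
  refine ⟨2 * Real.exp K, (hP.eventually_isFlat one_pos).mono ?_⟩
  rintro n ⟨hn, ε, h0, h1, hflat⟩
  refine ⟨(differentiable_scaled _ _).differentiableOn, fun s hs => ?_⟩
  refine (hflat.norm_scaled_le hn h0 s).trans ?_
  have : |s.im| < K := hs
  gcongr
  linarith

theorem IsUltraflat.isStripBounded_scaledConj (hP : IsUltraflat P) :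
    IsStripBounded fun n => scaledConj n (P n) := by
  intro K
  refine ⟨2 * Real.exp K, (hP.eventually_isFlat one_pos).mono ?_⟩
  rintro n ⟨hn, ε, h0, h1, hflat⟩
  refine ⟨(differentiable_scaledConj _ _).differentiableOn, fun s hs => ?_⟩
  refine (hflat.norm_scaledConj_le hn h0 s).trans ?_
  have : |s.im| < K := hs
  gcongr
  linarith

theorem IsUltraflat.isStripSmall_mul_sub_one (hP : IsUltraflat P) :
    IsStripSmall fun n s => scaled n (P n) s * scaledConj n (P n) s - 1 := by
  intro K c hc
  have hc' : 0 < min 1 (c / (3 * Real.exp K)) := lt_min one_pos (by positivity)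
  refine (hP.eventually_isFlat hc').mono ?_
  rintro n ⟨hn, ε, h0, h1, hflat⟩
  refine ⟨(((differentiable_scaled _ _).mul
    (differentiable_scaledConj _ _)).sub_const 1).differentiableOn, fun s hs => ?_⟩
  refine (hflat.norm_scaled_mul_scaledConj_sub_one_le hn h0
    (h1.trans (min_le_left _ _)) s).trans ?_
  have : |s.im| < K := hs
  have h2 := h1.trans (min_le_right _ _)
  calc 3 * ε * Real.exp |s.im| ≤ 3 * (c / (3 * Real.exp K)) * Real.exp K := by gcongr
    _ = c := by field_simp

/-- Once |f f* − 1| ≤ 1/2 one has |f f*| ≥ 1/2, so the reflection controls 1/f. -/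
theorem IsUltraflat.eventually_norm_inv_scaled_le (hP : IsUltraflat P) (K : ℝ) :
    ∀ᶠ n in atTop, ∀ s ∈ strip K, scaled n (P n) s ≠ 0 ∧
      ‖(scaled n (P n) s)⁻¹‖ ≤ 2 * ‖scaledConj n (P n) s‖ := by
  filter_upwards [hP.isStripSmall_mul_sub_one K (1 / 2) (by norm_num)] with n hn s hs
  have h := hn.2 s hs
  set a := scaled n (P n) s
  set b := scaledConj n (P n) s
  have h1 : 1 / 2 ≤ ‖a * b‖ := by
    have := norm_sub_norm_le (1 : ℂ) (1 - a * b)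
    rw [norm_one, sub_sub_cancel, norm_sub_rev] at this
    linarith
  have ha : a ≠ 0 := by
    rintro ha
    rw [ha, zero_mul, norm_zero] at h1
    norm_num at h1
  refine ⟨ha, ?_⟩
  have hpos : 0 < ‖a‖ := norm_pos_iff.mpr ha
  rw [norm_mul] at h1
  rw [norm_inv, inv_le_iff_one_le_mul₀ hpos]
  linarith

theorem IsUltraflat.isStripBounded_inv_scaled (hP : IsUltraflat P) :
    IsStripBounded fun n s => (scaled n (P n) s)⁻¹ := by
  intro K
  obtain ⟨M, hM⟩ := hP.isStripBounded_scaledConj K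
  refine ⟨2 * M, ?_⟩
  filter_upwards [hM, hP.eventually_norm_inv_scaled_le K] with n h1 h2
  refine ⟨(differentiable_scaled _ _).differentiableOn.inv fun s hs => (h2 s hs).1, fun s hs => ?_⟩
  linarith [(h2 s hs).2, h1.2 s hs]

/-! ### The angular speed varies slowly -/

/-- Second derivative of the logarithm of a zero-free holomorphic function on a disc, in terms of
two-sided bounds for its modulus. -/
theorem norm_deriv_logDeriv_le {f : ℂ → ℂ} {c : ℂ} {R A : ℝ} (hR : 0 < R) (hA : 1 < A)
    (hf : DifferentiableOn ℂ f (Metric.ball c R)) (h0 : ∀ w ∈ Metric.ball c R, f w ≠ 0)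
    (hle : ∀ w ∈ Metric.ball c R, ‖f w‖ ≤ A) (hinv : ‖(f c)⁻¹‖ ≤ A) :
    ‖deriv (fun w => deriv f w / f w) c‖ ≤ 32 * Real.log A / R ^ 2 := by
  have hcmem : c ∈ Metric.ball c R := Metric.mem_ball_self hR
  have hq : DifferentiableOn ℂ (fun w => deriv f w / f w) (Metric.ball c R) :=
    (hf.deriv Metric.isOpen_ball).div hf h0
  -- L is the branch of log(f / f(c)) vanishing at c, obtained as a primitive of f'/f.
  obtain ⟨L, hL0, hL⟩ := hq.isExactOn_ball.with_val_at c 0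
  have hconst : ∀ w ∈ Metric.ball c R, f w * exp (-L w) = f c := by
    intro w hw
    have hd : ∀ x ∈ Metric.ball c R, HasDerivAt (fun w => f w * exp (-L w)) 0 x := by
      intro x hx
      have h1 := (hf.differentiableAt (Metric.isOpen_ball.mem_nhds hx)).hasDerivAt
      refine (h1.mul (hL x hx).neg.cexp).congr_deriv ?_
      have := h0 x hx
      field_simp
      ring
    have := (convex_ball c R).is_const_of_fderivWithin_eq_zero (𝕜 := ℂ)
      (f := fun w => f w * exp (-L w))
      (fun x hx => (hd x hx).differentiableAt.differentiableWithinAt)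
      (fun x hx => by
        rw [fderivWithin_of_isOpen Metric.isOpen_ball hx]
        ext
        simp [(hd x hx).deriv]) hw hcmem
    simpa [hL0] using this
  have hlogA : 0 < Real.log A := Real.log_pos hA
  have hre : ∀ w ∈ Metric.ball c R, (L w).re ≤ 2 * Real.log A := by
    intro w hw
    have e : exp (L w) = f w * (f c)⁻¹ := by
      have h1 := h0 w hw
      have h2 := exp_ne_zero (L w)
      rw [← hconst w hw, exp_neg]
      field_simp
    have h3 : Real.exp (L w).re ≤ A * A := by
      rw [← norm_exp, e, norm_mul]
      exact mul_le_mul (hle w hw) hinv (norm_nonneg _) (by linarith)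
    have h4 := (Real.le_log_iff_exp_le (by positivity)).mpr h3
    rw [Real.log_mul (by positivity) (by positivity)] at h4
    linarith
  have hLd : DifferentiableOn ℂ L (Metric.ball c R) :=
    fun x hx => (hL x hx).differentiableAt.differentiableWithinAt
  have hmaps : Set.MapsTo (fun w : ℂ => c + w) (Metric.ball 0 R) (Metric.ball c R) := by
    intro w hw
    simpa using hw
  -- Borel–Carathéodory turns the one-sided bound on Re L into a bound on |L|; at half the radius it
  -- is twice the bound on the real part.
  have hLbound : ∀ z ∈ Metric.sphere c (R / 2), ‖L z‖ ≤ 4 * Real.log A := by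
    intro z hz
    have hz' : ‖z - c‖ = R / 2 := by simpa [dist_eq_norm] using hz
    have h := borelCaratheodory_zero (f := fun w => L (c + w)) (M := 2 * Real.log A) (R := R)
      (z := z - c) (by positivity) (hLd.comp (by fun_prop) hmaps)
      (fun w hw => hre _ (hmaps hw)) hR (by simp [hz', hR]) (by simpa using hL0)
    rw [add_sub_cancel, hz'] at h
    refine h.trans (le_of_eq ?_)
    field_simp
    ring
  -- Cauchy's estimate for the second derivative: 2! · 4 log A / (R/2)² = 32 log A / R².
  have hC := norm_iteratedDeriv_le_of_forall_mem_sphere_norm_le 2 (half_pos hR)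
    (hLd.diffContOnCl_ball (Metric.closedBall_subset_ball (half_lt_self hR))) hLbound
  have hev : deriv L =ᶠ[𝓝 c] fun w => deriv f w / f w := by
    filter_upwards [Metric.isOpen_ball.mem_nhds hcmem] with w hw using (hL w hw).deriv
  rw [iteratedDeriv_succ, iteratedDeriv_one, hev.deriv_eq] at hC
  refine hC.trans (le_of_eq ?_)
  simp only [Nat.factorial]
  push_cast
  field_simp
  ring

/-- The (complexified) angular speed `-i f' / f` of the rescaled polynomial. -/
noncomputable def angularSpeed (n : ℕ) (p : ℂ[X]) (s : ℂ) : ℂ :=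
  -I * (deriv (scaled n p) s / scaled n p s)

theorem IsUltraflat.isStripBounded_angularSpeed (hP : IsUltraflat P) :
    IsStripBounded fun n => angularSpeed n (P n) :=
  ((hP.isStripBounded_scaled.deriv.mul hP.isStripBounded_inv_scaled).const_mul (-I)).congr
    fun _ => Eventually.of_forall fun _ _ _ => by simp only [angularSpeed, div_eq_mul_inv]

/-- On a disc of radius R the logarithms of the bounds for f and 1/f grow only linearly in R,
against R² in the denominator. R is fixed first, then n is taken large enough for the strip of
half-width K + R. -/
theorem IsUltraflat.isStripSmall_deriv_angularSpeed (hP : IsUltraflat P) :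
    IsStripSmall fun n => deriv (angularSpeed n (P n)) := by
  intro K c hc
  have hlim : Tendsto (fun R : ℝ => 32 * (Real.log 4 + K + R) / R ^ 2) atTop (𝓝 0) := by
    have h1 : Tendsto (fun R : ℝ => 32 * (Real.log 4 + K) * (R⁻¹) ^ 2 + 32 * R⁻¹) atTop (𝓝 0) := by
      have := tendsto_inv_atTop_zero (𝕜 := ℝ)
      simpa using ((this.pow 2).const_mul (32 * (Real.log 4 + K))).add (this.const_mul 32)
    refine h1.congr' ?_
    filter_upwards [eventually_gt_atTop 0] with R hR
    field_simp
  obtain ⟨R, hRc, hR0, hRK⟩ := ((hlim.eventually_le_const hc).and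
    ((eventually_gt_atTop 0).and (eventually_ge_atTop (-K)))).exists
  filter_upwards [hP.isStripBounded_angularSpeed.eventually_differentiableOn K,
    hP.eventually_isFlat one_pos, hP.eventually_norm_inv_scaled_le (K + R)] with n hd hflat hinv
  obtain ⟨hn, ε, hε0, hε1, hflat⟩ := hflat
  refine ⟨differentiableOn_deriv_strip hd, fun s hs => ?_⟩
  have hsub : Metric.ball s R ⊆ strip (K + R) :=
    Metric.ball_subset_closedBall.trans (closedBall_subset_strip hs)
  have hexp : 1 ≤ Real.exp (K + R) := Real.one_le_exp (by linarith)
  -- For A: |f| and |f*| are at most 2e^{K+R}, and |1/f| ≤ 2|f*|. The choice R ≥ −K ensures A > 1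
  -- even for negative K.
  have h := norm_deriv_logDeriv_le (f := scaled n (P n)) (c := s) (R := R)
    (A := 4 * Real.exp (K + R)) hR0 (by linarith) (differentiable_scaled _ _).differentiableOn
    (fun w hw => (hinv w (hsub hw)).1) ?_ ?_
  · have e : deriv (angularSpeed n (P n)) s
        = -I * deriv (fun w => deriv (scaled n (P n)) w / scaled n (P n) w) s := by
      have h0 := (hinv s (hsub (Metric.mem_ball_self hR0))).1
      have hdd : DifferentiableAt ℂ (fun w => deriv (scaled n (P n)) w / scaled n (P n) w) s :=
        ((differentiable_scaled n (P n)).deriv s).div (differentiable_scaled n (P n) s) h0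
      exact (hdd.hasDerivAt.const_mul (-I)).deriv
    rw [e, norm_mul, norm_neg, norm_I, one_mul]
    refine h.trans (le_trans (le_of_eq ?_) hRc)
    rw [Real.log_mul (by norm_num) (Real.exp_ne_zero _), Real.log_exp]
    ring
  · intro w hw
    have hw' : |w.im| < K + R := hsub hw
    calc _ ≤ _ := hflat.norm_scaled_le hn hε0 w
      _ ≤ 4 * Real.exp (K + R) := by
        gcongr
        linarith
  · have hs' : |s.im| < K + R := hsub (Metric.mem_ball_self hR0)
    have h2 : ‖scaledConj n (P n) s‖ ≤ 2 * Real.exp (K + R) :=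
      calc _ ≤ _ := hflat.norm_scaledConj_le hn hε0 s
        _ ≤ 2 * Real.exp (K + R) := by
          gcongr
          linarith
    linarith [(hinv s (hsub (Metric.mem_ball_self hR0))).2]

/-! ### Moments of the angular speed -/

/-- The `m`-th iterate of `-i d/ds` applied to `scaled n p`. -/
noncomputable def scaledIter (m n : ℕ) (p : ℂ[X]) (s : ℂ) : ℂ :=
  ∑ k ∈ Finset.range (n + 1),
    p.coeff k * ((k : ℂ) / n) ^ m * exp (k * (s * I / n)) / (Real.sqrt ((n : ℝ) + 1) : ℂ)

theorem scaledIter_zero {n : ℕ} {p : ℂ[X]} (hp : p.natDegree ≤ n) (s : ℂ) :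
    scaledIter 0 n p s = scaled n p s := by
  rw [scaledIter, scaled, p.eval_eq_sum_range' (Nat.lt_succ_of_le hp), Finset.sum_div]
  refine Finset.sum_congr rfl fun k _ => ?_
  rw [pow_zero, mul_one, exp_nat_mul]

theorem hasDerivAt_scaledIter (m n : ℕ) (p : ℂ[X]) (s : ℂ) :
    HasDerivAt (scaledIter m n p) (I * scaledIter (m + 1) n p s) s := by
  unfold scaledIter
  rw [Finset.mul_sum]
  refine HasDerivAt.fun_sum fun k _ => ?_
  have h : HasDerivAt (fun s : ℂ => (k : ℂ) * (s * I / n)) (k * (1 * I / n)) s :=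
    (((hasDerivAt_id s).mul_const I).div_const _).const_mul _
  refine ((h.cexp.const_mul _).div_const _).congr_deriv ?_
  ring

theorem deriv_scaled_eq {n : ℕ} {p : ℂ[X]} {s : ℂ} (h : scaled n p s ≠ 0) :
    deriv (scaled n p) s = I * angularSpeed n p s * scaled n p s := by
  rw [angularSpeed]
  field_simp
  linear_combination deriv (scaled n p) s * I_sq

/-- Induction on m: applying −i d/ds to λ^m f gives λ^{m+1} f − i m λ' λ^{m−1} f, whose last term is
small because λ' is, and differentiation preserves smallness on strips. -/
theorem IsUltraflat.isStripSmall_scaledIter_sub (hP : IsUltraflat P) (m : ℕ) :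
    IsStripSmall fun n s =>
      scaledIter m n (P n) s - angularSpeed n (P n) s ^ m * scaled n (P n) s := by
  induction m with
  | zero =>
    refine isStripSmall_zero.congr fun K => ?_
    filter_upwards [hP.eventually_isFlat one_pos] with n ⟨_, ε, _, _, hflat⟩ s _
    simp [scaledIter_zero (unimodular.natDegree_le hflat.1)]
  | succ m ih =>
    -- At m = 0 the truncated exponent m − 1 is harmless: the term carries the factor m.
    have h2 := ((hP.isStripSmall_deriv_angularSpeed.mul_bounded
      (hP.isStripBounded_angularSpeed.pow (m - 1))).mul_bounded
      hP.isStripBounded_scaled).const_mul (I * m)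
    refine ((ih.deriv.const_mul (-I)).sub h2).congr fun K => ?_
    filter_upwards [hP.eventually_norm_inv_scaled_le K,
      hP.isStripBounded_angularSpeed.eventually_differentiableOn K] with n h0 hd s hs
    have hl := (hd.differentiableAt ((isOpen_strip K).mem_nhds hs)).hasDerivAt
    have hf := (differentiable_scaled n (P n) s).hasDerivAt
    rw [deriv_scaled_eq (h0 s hs).1] at hf
    have hD : deriv (fun s => scaledIter m n (P n) s - angularSpeed n (P n) s ^ m *
        scaled n (P n) s) s = _ :=
      ((hasDerivAt_scaledIter m n (P n) s).sub ((hl.fun_pow m).mul hf)).deriv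
    simp only [hD]
    linear_combination
      (scaledIter (m + 1) n (P n) s - angularSpeed n (P n) s ^ (m + 1) * scaled n (P n) s) * I_sq

theorem integral_exp_natCast_sub_mul_I (j k : ℕ) :
    ∫ t in (0 : ℝ)..2 * Real.pi, exp (((k : ℂ) - j) * I * t)
      = if j = k then 2 * (Real.pi : ℂ) else 0 := by
  split_ifs with h
  · subst h
    simp
  · have hc : ((k : ℂ) - j) * I ≠ 0 :=
      mul_ne_zero (sub_ne_zero.mpr (by exact_mod_cast Ne.symm h)) I_ne_zero
    rw [integral_exp_mul_complex hc]
    have : exp (((k : ℂ) - j) * I * (2 * Real.pi : ℝ)) = 1 := by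
      rw [exp_eq_one_iff]
      refine ⟨(k : ℤ) - j, ?_⟩
      push_cast
      ring
    rw [this]
    simp

/-- Parseval: only the diagonal survives, with weights |a_k|². Here the coefficients having modulus
one is essential. -/
theorem integral_scaledConj_mul_scaledIter {n : ℕ} (hn : 1 ≤ n) {p : ℂ[X]}
    (hp : p ∈ unimodular n) (m : ℕ) :
    ∫ t in (0 : ℝ)..2 * Real.pi,
      scaledConj n p ((n : ℂ) * t) * scaledIter m n p ((n : ℂ) * t)
      = 2 * Real.pi * ((∑ k ∈ Finset.range (n + 1), ((k : ℂ) / n) ^ m) / ((n : ℂ) + 1)) := by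
  have hn0 : (n : ℂ) ≠ 0 := Nat.cast_ne_zero.mpr (by omega)
  have key : ∀ t : ℝ, scaledConj n p ((n : ℂ) * t) * scaledIter m n p ((n : ℂ) * t)
      = ∑ j ∈ Finset.range (n + 1), ∑ k ∈ Finset.range (n + 1),
        (conj (p.coeff j) * p.coeff k * ((k : ℂ) / n) ^ m / ((n : ℂ) + 1)) *
          exp (((k : ℂ) - j) * I * t) := by
    intro t
    have hc : conj ((n : ℂ) * t) = (n : ℂ) * t := by simp
    rw [scaledConj, hc, ← scaledIter_zero (unimodular.natDegree_le hp), scaledIter, scaledIter,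
      map_sum, Finset.sum_mul_sum]
    refine Finset.sum_congr rfl fun j _ => Finset.sum_congr rfl fun k _ => ?_
    rw [← sqrt_succ_sq]
    simp only [pow_zero, mul_one, map_div₀, map_mul, conj_ofReal, ← exp_conj, map_natCast, conj_I]
    have e : exp (((k : ℂ) - j) * I * t) = exp ((j : ℂ) * ((n : ℂ) * t * -I / n)) *
        exp ((k : ℂ) * ((n : ℂ) * t * I / n)) := by
      rw [← exp_add]
      congr 1
      field_simp
      ring
    rw [e]
    ring
  simp only [key]
  have hint : ∀ j k : ℕ, IntervalIntegrable (fun t : ℝ =>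
      (conj (p.coeff j) * p.coeff k * ((k : ℂ) / n) ^ m / ((n : ℂ) + 1)) *
          exp (((k : ℂ) - j) * I * t)) volume 0 (2 * Real.pi) := fun j k =>
    Continuous.intervalIntegrable (by fun_prop) _ _
  rw [intervalIntegral.integral_finsetSum fun j _ =>
    Continuous.intervalIntegrable (by fun_prop) _ _]
  simp only [intervalIntegral.integral_finsetSum fun k (_ : k ∈ Finset.range (n + 1)) =>
    hint _ k]
  simp only [intervalIntegral.integral_const_mul, integral_exp_natCast_sub_mul_I, mul_ite, mul_zero,
    Finset.sum_ite_eq]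
  rw [Finset.sum_div, Finset.mul_sum]
  refine Finset.sum_congr rfl fun j hj => ?_
  have hj' := Nat.lt_succ_iff.mp (Finset.mem_range.mp hj)
  rw [if_pos hj, ← normSq_eq_conj_mul_self, normSq_eq_norm_sq, unimodular.norm_coeff hp hj']
  push_cast
  ring

theorem tendsto_sum_div_pow (m : ℕ) :
    Tendsto (fun n : ℕ => (∑ k ∈ Finset.range (n + 1), ((k : ℝ) / n) ^ m) / ((n : ℝ) + 1))
      atTop (𝓝 (1 / ((m : ℝ) + 1))) := by
  have hmono : ∀ n : ℕ, MonotoneOn (fun x : ℝ => x ^ m) (Set.Icc 0 (0 + (n : ℝ))) :=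
    fun n x hx y _ hxy => pow_le_pow_left₀ hx.1 hxy m
  have hint : ∀ n : ℕ, ∫ x in (0 : ℝ)..0 + (n : ℝ), x ^ m = (n : ℝ) ^ (m + 1) / (m + 1) := by
    intro n
    simp [integral_pow]
  have hlow : ∀ n : ℕ, (n : ℝ) ^ (m + 1) / (m + 1) ≤
      ∑ k ∈ Finset.range (n + 1), (k : ℝ) ^ m := by
    intro n
    have h := (hmono n).integral_le_sum
    rw [hint] at h
    -- The term k = 0 is split off here, and k = n in the upper bound, so that the remaining n terms
    -- fit the comparison with the integral.
    rw [Finset.sum_range_succ']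
    have : (0 : ℝ) ≤ ((0 : ℕ) : ℝ) ^ m := by positivity
    simp only [zero_add] at h
    exact h.trans (le_add_of_nonneg_right this)
  have hup : ∀ n : ℕ, ∑ k ∈ Finset.range (n + 1), (k : ℝ) ^ m ≤
      (n : ℝ) ^ (m + 1) / (m + 1) + (n : ℝ) ^ m := by
    intro n
    have h := (hmono n).sum_le_integral
    rw [hint] at h
    rw [Finset.sum_range_succ]
    simp only [zero_add] at h
    linarith
  have hinv : Tendsto (fun n : ℕ => ((n : ℝ) + 1)⁻¹) atTop (𝓝 0) := by
    simpa using tendsto_one_div_add_atTop_nhds_zero_nat (𝕜 := ℝ)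
  have hl : Tendsto (fun n : ℕ => 1 / ((m : ℝ) + 1) * (1 - ((n : ℝ) + 1)⁻¹)) atTop
      (𝓝 (1 / ((m : ℝ) + 1))) := by
    simpa using (hinv.const_sub 1).const_mul (1 / ((m : ℝ) + 1))
  have hu : Tendsto (fun n : ℕ => 1 / ((m : ℝ) + 1) * (1 - ((n : ℝ) + 1)⁻¹) + ((n : ℝ) + 1)⁻¹)
      atTop (𝓝 (1 / ((m : ℝ) + 1))) := by
    simpa using hl.add hinv
  have hsum : ∀ n : ℕ, ∑ k ∈ Finset.range (n + 1), ((k : ℝ) / n) ^ m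
      = (∑ k ∈ Finset.range (n + 1), (k : ℝ) ^ m) / (n : ℝ) ^ m := by
    intro n
    rw [Finset.sum_div]
    exact Finset.sum_congr rfl fun k _ => div_pow _ _ _
  refine tendsto_of_tendsto_of_tendsto_of_le_of_le' hl hu ?_ ?_
  all_goals
    filter_upwards [eventually_ge_atTop 1] with n hn
    have hn0 : (0 : ℝ) < n := by exact_mod_cast hn
    rw [hsum, div_div]
  · rw [le_div_iff₀ (by positivity)]
    refine le_trans (le_of_eq ?_) (hlow n)
    field_simp
    ring
  · rw [div_le_iff₀ (by positivity)]
    refine (hup n).trans (le_of_eq ?_)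
    field_simp
    ring

/-- Since f f* ≈ 1, λ^m ≈ f* λ^m f ≈ f* (−i d/ds)^m f, and the mean of the last expression is a
Riemann sum for ∫₀¹ x^m dx. -/
theorem IsUltraflat.tendsto_integral_angularSpeed_pow (hP : IsUltraflat P) (m : ℕ) :
    Tendsto (fun n : ℕ => ∫ t in (0 : ℝ)..2 * Real.pi, angularSpeed n (P n) ((n : ℂ) * t) ^ m)
      atTop (𝓝 (2 * Real.pi * (1 / ((m : ℂ) + 1)))) := by
  have hlamf := (hP.isStripBounded_angularSpeed.pow m).mul hP.isStripBounded_scaled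
  have hiter : IsStripBounded fun n => scaledIter m n (P n) :=
    ((hP.isStripSmall_scaledIter_sub m).isStripBounded.add hlamf).congr
      fun _ => Eventually.of_forall fun _ _ _ => by simp
  have hd : IsStripSmall fun n s => angularSpeed n (P n) s ^ m -
      scaledConj n (P n) s * scaledIter m n (P n) s := by
    refine (((hP.isStripBounded_scaledConj.mul_small (hP.isStripSmall_scaledIter_sub m)).add
      ((hP.isStripBounded_angularSpeed.pow m).mul_small
        hP.isStripSmall_mul_sub_one)).const_mul (-1)).congr
        fun _ => Eventually.of_forall fun _ _ _ => ?_
    ring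
  refine hd.tendsto_integral_of_sub (hP.isStripBounded_scaledConj.mul hiter) ?_
  have h := (tendsto_sum_div_pow m).ofReal.const_mul (2 * (Real.pi : ℂ))
  push_cast at h
  refine h.congr' ?_
  filter_upwards [hP.eventually_isFlat one_pos] with n ⟨hn, ε, _, _, hflat⟩
  rw [integral_scaledConj_mul_scaledIter hn hflat.1]

/-- The angular speed is uniformly distributed in `[0, 1]`, tested against polynomials. -/
theorem IsUltraflat.tendsto_integral_eval_angularSpeed (hP : IsUltraflat P) (p : ℂ[X]) :
    Tendsto (fun n : ℕ => ∫ t in (0 : ℝ)..2 * Real.pi, p.eval (angularSpeed n (P n) ((n : ℂ) * t)))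
      atTop (𝓝 (2 * Real.pi * ∫ x in (0 : ℝ)..1, p.eval (x : ℂ))) := by
  induction p using Polynomial.induction_on' with
  | add p r hp hr =>
    have hc : ∀ p : ℂ[X], IntervalIntegrable (fun x : ℝ => p.eval (x : ℂ)) volume 0 1 := fun p =>
      (p.continuous.comp continuous_ofReal).intervalIntegrable _ _
    simp only [eval_add, intervalIntegral.integral_add (hc p) (hc r), mul_add]
    refine (hp.add hr).congr' ?_
    filter_upwards [(hP.isStripBounded_angularSpeed.eval p).eventually_continuous,
      (hP.isStripBounded_angularSpeed.eval r).eventually_continuous] with n h1 h2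
    rw [← intervalIntegral.integral_add (h1.intervalIntegrable _ _) (h2.intervalIntegrable _ _)]
  | monomial m a =>
    have h := (hP.tendsto_integral_angularSpeed_pow m).const_mul a
    simp only [eval_monomial, intervalIntegral.integral_const_mul]
    have e : ∫ x in (0 : ℝ)..1, (x : ℂ) ^ m = 1 / ((m : ℂ) + 1) := by
      have := integral_pow (a := 0) (b := 1) m
      simp only [one_pow, ne_eq, Nat.add_eq_zero_iff, one_ne_zero, and_false, not_false_eq_true,
        zero_pow, sub_zero] at this
      rw [← ofReal_one, ← ofReal_natCast, ← ofReal_add, ← ofReal_div, ← this,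
        ← intervalIntegral.integral_ofReal]
      simp
    rw [e]
    convert h using 2
    ring

/-! ### Asymptotic reality of the angular speed and means of derivatives -/

theorem IsStripBounded.reflect (hh : IsStripBounded h) :
    IsStripBounded fun n s => conj (h n (conj s)) := by
  intro K
  obtain ⟨M, hM⟩ := hh K
  refine ⟨M, hM.mono fun n hn => ?_⟩
  have hmem : ∀ s ∈ strip K, conj s ∈ strip K := by
    intro s hs
    simpa [strip] using hs
  refine ⟨fun s hs => ?_, fun s hs => by simpa using hn.2 _ (hmem s hs)⟩
  have := (hn.1.differentiableAt ((isOpen_strip K).mem_nhds (hmem s hs))).hasDerivAt.conj_conj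
  rw [conj_conj] at this
  exact this.differentiableAt.differentiableWithinAt

/-- The angular speed is asymptotically real on the real axis, in the strong sense that it is
close to its own Schwarz reflection. -/
theorem IsUltraflat.isStripSmall_angularSpeed_sub_reflect (hP : IsUltraflat P) :
    IsStripSmall fun n s => angularSpeed n (P n) s - conj (angularSpeed n (P n) (conj s)) := by
  -- The difference of λ and its reflection is exactly −i (f f*)' / (f f*), and (f f*)' = (f f* −
  -- 1)' is small.
  refine ((((hP.isStripSmall_mul_sub_one.deriv).mul_bounded
    hP.isStripBounded_inv_scaled).mul_bounded
      hP.isStripBounded_inv_scaled.reflect).const_mul (-I)).congr fun K => ?_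
  filter_upwards [hP.eventually_norm_inv_scaled_le K] with n hn s hs
  have hs' : conj s ∈ strip K := by simpa [strip] using hs
  have h1 := (hn s hs).1
  have h2 : conj (scaled n (P n) (conj s)) ≠ 0 := by simpa using (hn _ hs').1
  have hd := (((differentiable_scaled n (P n) s).hasDerivAt.mul
    (hasDerivAt_scaledConj n (P n) s)).sub_const 1).deriv
  have hd' : deriv (fun s => scaled n (P n) s * scaledConj n (P n) s - 1) s = _ := hd
  simp only [hd']
  simp only [scaledConj, angularSpeed, map_mul, map_neg, conj_I, map_div₀, map_inv₀]
  field_simp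
  ring

/-- The integrand is the t-derivative of h(nt)/n, so boundedness of h alone makes the integral
O(1/n); no periodicity is needed. -/
theorem IsStripBounded.tendsto_integral_deriv (hh : IsStripBounded h) :
    Tendsto (fun n : ℕ => ∫ t in (0 : ℝ)..2 * Real.pi, _root_.deriv (h n) ((n : ℂ) * t))
      atTop (𝓝 0) := by
  obtain ⟨M, hM⟩ := hh 1
  have hlim : Tendsto (fun n : ℕ => 2 * M / (n : ℝ)) atTop (𝓝 0) :=
    tendsto_const_nhds.div_atTop tendsto_natCast_atTop_atTop
  refine squeeze_zero_norm' ?_ hlim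
  filter_upwards [hM, hh.deriv.eventually_continuous, eventually_ge_atTop 1] with n hn hc h1
  have hn0 : (n : ℂ) ≠ 0 := Nat.cast_ne_zero.mpr (by omega)
  have hd : ∀ t : ℝ, HasDerivAt (fun t : ℝ => h n ((n : ℂ) * t) / n)
      (_root_.deriv (h n) ((n : ℂ) * t)) t := by
    intro t
    have h2 : HasDerivAt (h n) (_root_.deriv (h n) ((n : ℂ) * t)) ((n : ℂ) * t) :=
      (hn.1.differentiableAt ((isOpen_strip 1).mem_nhds
        (natCast_mul_ofReal_mem_strip n t))).hasDerivAt
    have h3 : HasDerivAt (fun z : ℂ => (n : ℂ) * z) (n * 1) (t : ℂ) :=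
      (hasDerivAt_id _).const_mul _
    refine ((h2.comp (t : ℂ) h3).comp_ofReal.div_const (n : ℂ)).congr_deriv ?_
    field_simp
  rw [intervalIntegral.integral_eq_sub_of_hasDerivAt (fun t _ => hd t)
    (hc.intervalIntegrable _ _), ← sub_div, norm_div, norm_natCast]
  gcongr
  refine (norm_sub_le _ _).trans ?_
  linarith [hn.2 _ (natCast_mul_ofReal_mem_strip n (2 * Real.pi)),
    hn.2 _ (natCast_mul_ofReal_mem_strip n 0)]

/-! ### Vanishing means of the powers of W -/

/-- The square of the rescaled polynomial with its central frequency removed. -/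
noncomputable def centeredSq (n : ℕ) (p : ℂ[X]) (s : ℂ) : ℂ :=
  exp (-I * s) * scaled n p s ^ 2

theorem norm_centeredSq_ofReal (n : ℕ) (p : ℂ[X]) (t : ℝ) :
    ‖centeredSq n p ((n : ℂ) * t)‖ = ‖scaled n p ((n : ℂ) * t)‖ ^ 2 := by
  have : -I * ((n : ℂ) * t) = ((-(n * t) : ℝ) : ℂ) * I := by
    push_cast
    ring
  rw [centeredSq, norm_mul, norm_pow, this, norm_exp_ofReal_mul_I, one_mul]

theorem IsUltraflat.isStripBounded_centeredSq (hP : IsUltraflat P) :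
    IsStripBounded fun n => centeredSq n (P n) := by
  have hexp : IsStripBounded fun _ s => exp (-I * s) := by
    refine fun K => ⟨Real.exp K, Eventually.of_forall fun n => ⟨?_, fun s hs => ?_⟩⟩
    · fun_prop
    · have hs' : |s.im| < K := hs
      rw [norm_exp, Real.exp_le_exp]
      simpa using (le_abs_self _).trans hs'.le
  exact hexp.mul (hP.isStripBounded_scaled.pow 2)

theorem hasDerivAt_centeredSq {n : ℕ} {p : ℂ[X]} {s : ℂ} (h0 : scaled n p s ≠ 0) :
    HasDerivAt (centeredSq n p) (2 * I * (angularSpeed n p s - 1 / 2) * centeredSq n p s) s := by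
  have hf := (differentiable_scaled n p s).hasDerivAt
  rw [deriv_scaled_eq h0] at hf
  have he : HasDerivAt (fun s : ℂ => exp (-I * s)) (exp (-I * s) * (-I * 1)) s :=
    ((hasDerivAt_id s).const_mul (-I)).cexp
  refine (he.mul (hf.fun_pow 2)).congr_deriv ?_
  rw [centeredSq]
  push_cast
  ring

theorem hasDerivAt_eval_mul_centeredSq_pow {n : ℕ} {p : ℂ[X]} {s l : ℂ} (h0 : scaled n p s ≠ 0)
    (hl : HasDerivAt (angularSpeed n p) l s) (ψ : ℂ[X]) (k : ℕ) :
    HasDerivAt (fun s => ψ.eval (angularSpeed n p s) * centeredSq n p s ^ k)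
      (l * (derivative ψ).eval (angularSpeed n p s) * centeredSq n p s ^ k + 2 * I * k *
        (((X - C (1 / 2)) * ψ).eval (angularSpeed n p s) * centeredSq n p s ^ k)) s := by
  have h1 : HasDerivAt (fun s => ψ.eval (angularSpeed n p s))
      ((derivative ψ).eval (angularSpeed n p s) * l) s :=
    (ψ.hasDerivAt (angularSpeed n p s)).comp s hl
  refine (h1.mul ((hasDerivAt_centeredSq h0).fun_pow k)).congr_deriv ?_
  simp only [eval_mul, eval_sub, eval_X, eval_C]
  cases k with
  | zero => simp [mul_comm]
  | succ j =>
    simp only [Nat.add_sub_cancel]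
    push_cast
    ring

/-- Integration by parts without a stationary point: writing p = (X − 1/2)ψ, the integrand is
(2ik)⁻¹ (ψ(λ) W^k)' up to a term containing λ', which is small. -/
theorem IsUltraflat.tendsto_integral_eval_mul_centeredSq_pow (hP : IsUltraflat P) {p : ℂ[X]}
    (hp : p.eval (1 / 2) = 0) {k : ℕ} (hk : k ≠ 0) :
    Tendsto (fun n : ℕ => ∫ t in (0 : ℝ)..2 * Real.pi,
      p.eval (angularSpeed n (P n) ((n : ℂ) * t)) * centeredSq n (P n) ((n : ℂ) * t) ^ k)
      atTop (𝓝 0) := by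
  obtain ⟨ψ, rfl⟩ := dvd_iff_isRoot.mpr hp
  have hlam := hP.isStripBounded_angularSpeed
  have hW := hP.isStripBounded_centeredSq.pow k
  have hH := (hlam.eval ψ).mul hW
  have hk0 : (2 * I * k : ℂ) ≠ 0 := by
    simp [hk]
  have hsmall := (hP.isStripSmall_deriv_angularSpeed.mul_bounded
    (hlam.eval (derivative ψ))).mul_bounded hW
  have hlim := hH.tendsto_integral_deriv.const_mul (2 * I * k : ℂ)⁻¹
  rw [mul_zero] at hlim
  simp only [← intervalIntegral.integral_const_mul] at hlim
  have hsub : IsStripSmall fun n s =>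
      ((X - C (1 / 2)) * ψ).eval (angularSpeed n (P n) s) * centeredSq n (P n) s ^ k -
      (2 * I * k : ℂ)⁻¹ *
        deriv (fun s => ψ.eval (angularSpeed n (P n) s) * centeredSq n (P n) s ^ k) s := by
    refine (hsmall.const_mul (-(2 * I * k : ℂ)⁻¹)).congr fun K => ?_
    filter_upwards [hP.eventually_norm_inv_scaled_le K,
      hlam.eventually_differentiableOn K] with n h0 hd s hs
    have hl := (hd.differentiableAt ((isOpen_strip K).mem_nhds hs)).hasDerivAt
    simp only [(hasDerivAt_eval_mul_centeredSq_pow (h0 s hs).1 hl ψ k).deriv]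
    field_simp
    ring
  exact hsub.tendsto_integral_of_sub (hH.deriv.const_mul (2 * I * k : ℂ)⁻¹) hlim

theorem tendsto_integral_bump_pow :
    Tendsto (fun N : ℕ => ∫ x in (0 : ℝ)..1, ((4 * x * (1 - x)) ^ N) ^ 2) atTop (𝓝 0) := by
  suffices Tendsto (fun N : ℕ => ∫ x in (0 : ℝ)..1, ((4 * x * (1 - x)) ^ N) ^ 2) atTop
      (𝓝 (∫ x in (0 : ℝ)..1, (0 : ℝ))) by simpa using this
  have hb : ∀ x ∈ Set.uIoc (0 : ℝ) 1, 0 ≤ 4 * x * (1 - x) ∧ 4 * x * (1 - x) ≤ 1 := by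
    intro x hx
    rw [Set.uIoc_of_le zero_le_one] at hx
    exact ⟨mul_nonneg (by linarith [hx.1]) (by linarith [hx.2]), by nlinarith [sq_nonneg (2 * x - 1)]⟩
  refine intervalIntegral.tendsto_integral_filter_of_dominated_convergence (fun _ => 1)
    (Eventually.of_forall fun N => Continuous.aestronglyMeasurable (by fun_prop))
    (Eventually.of_forall fun N => Eventually.of_forall fun x hx => ?_)
    intervalIntegrable_const ?_
  · obtain ⟨h1, h2⟩ := hb x hx
    rw [Real.norm_of_nonneg (by positivity)]
    exact pow_le_one₀ (by positivity) (pow_le_one₀ h1 h2)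
  · filter_upwards [compl_mem_ae_iff.mpr (measure_singleton (1 / 2 : ℝ))] with x hne hx
    obtain ⟨h1, h2⟩ := hb x hx
    have hlt : 4 * x * (1 - x) < 1 := by
      have : 0 < (2 * x - 1) ^ 2 := by
        have : 2 * x - 1 ≠ 0 := fun e => hne (by
          rw [Set.mem_singleton_iff]
          linarith)
        positivity
      nlinarith
    simpa using (tendsto_pow_atTop_nhds_zero_of_lt_one h1 hlt).pow 2

/-- The polynomial `(4 X (1 - X)) ^ N`, which equals one at `1 / 2` and concentrates there. -/
noncomputable def bump (N : ℕ) : ℂ[X] := (C 4 * X * (1 - X)) ^ N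

theorem bump_eval (N : ℕ) (z : ℂ) : (bump N).eval z = (4 * z * (1 - z)) ^ N := by
  simp [bump]

theorem conj_bump_eval (N : ℕ) (z : ℂ) : conj ((bump N).eval z) = (bump N).eval (conj z) := by
  simp [bump_eval, map_ofNat (starRingEnd ℂ) 4]

/-- λ need not be real on the real axis. As the bump has real coefficients, its squared modulus is
its value at λ times its value at the conjugate of λ; the latter point is close to λ, so the
polynomial limit applies. -/
theorem IsUltraflat.tendsto_integral_norm_bump_sq (hP : IsUltraflat P) (N : ℕ) :
    Tendsto (fun n : ℕ => ∫ t in (0 : ℝ)..2 * Real.pi,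
      ‖(bump N).eval (angularSpeed n (P n) ((n : ℂ) * t))‖ ^ 2) atTop
      (𝓝 (2 * Real.pi * ∫ x in (0 : ℝ)..1, ((4 * x * (1 - x)) ^ N) ^ 2)) := by
  have hlam := hP.isStripBounded_angularSpeed
  have hV := hlam.eval (bump N)
  have hdiff := (hP.isStripSmall_angularSpeed_sub_reflect.eval_sub_eval hlam hlam.reflect
    (bump N)).const_mul (-1)
  have hlim := hP.tendsto_integral_eval_angularSpeed (bump N ^ 2)
  simp only [eval_pow] at hlim
  have hsub := IsStripSmall.tendsto_integral_of_sub (h := fun n s =>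
      (bump N).eval (angularSpeed n (P n) s) * (bump N).eval (conj (angularSpeed n (P n) (conj s))))
    ((hV.mul_small hdiff).congr fun _ => Eventually.of_forall fun n s _ => by ring)
    (hV.pow 2) hlim
  have e1 : ∀ n : ℕ, ∫ t in (0 : ℝ)..2 * Real.pi,
      (bump N).eval (angularSpeed n (P n) ((n : ℂ) * t)) *
        (bump N).eval (conj (angularSpeed n (P n) (conj ((n : ℂ) * t))))
      = ((∫ t in (0 : ℝ)..2 * Real.pi,
        ‖(bump N).eval (angularSpeed n (P n) ((n : ℂ) * t))‖ ^ 2 : ℝ) : ℂ) := by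
    intro n
    rw [← intervalIntegral.integral_ofReal]
    congr 1
    ext t
    have hc : conj ((n : ℂ) * t) = (n : ℂ) * t := by simp
    rw [hc, ← conj_bump_eval, mul_conj, normSq_eq_norm_sq]
  have e2 : ∫ x in (0 : ℝ)..1, (bump N).eval (x : ℂ) ^ 2
      = ((∫ x in (0 : ℝ)..1, ((4 * x * (1 - x)) ^ N) ^ 2 : ℝ) : ℂ) := by
    rw [← intervalIntegral.integral_ofReal]
    congr 1
    ext x
    rw [bump_eval]
    push_cast
    rfl
  rw [e2] at hsub
  simp only [e1] at hsub
  rw [← tendsto_ofReal_iff ]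
  simpa using hsub

/-- Split 1 = (1 − B²) + B² with B the bump evaluated at λ. The first part vanishes at λ = 1/2 and
oscillates away; the second is bounded by a multiple of ∫|B|², whose limit is small once N is large.
N is chosen before n. -/
theorem IsUltraflat.tendsto_integral_centeredSq_pow (hP : IsUltraflat P) {k : ℕ} (hk : k ≠ 0) :
    Tendsto (fun n : ℕ => ∫ t in (0 : ℝ)..2 * Real.pi, centeredSq n (P n) ((n : ℂ) * t) ^ k)
      atTop (𝓝 0) := by
  rw [Metric.tendsto_nhds]
  intro c hc
  have hN := (tendsto_integral_bump_pow.const_mul (2 * Real.pi)).const_mul ((4 : ℝ) ^ k)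
  rw [mul_zero, mul_zero] at hN
  obtain ⟨N, hN⟩ := (hN.eventually_lt_const (half_pos hc)).exists
  have h1 := hP.tendsto_integral_eval_mul_centeredSq_pow (p := 1 - bump N ^ 2)
    (by simp [bump_eval]; norm_num) hk
  have h2 := ((hP.tendsto_integral_norm_bump_sq N).const_mul ((4 : ℝ) ^ k)).eventually_lt_const hN
  filter_upwards [h2, (Metric.tendsto_nhds.mp h1) (c / 2) (half_pos hc),
    hP.eventually_isFlat one_pos, (hP.isStripBounded_centeredSq.pow k).eventually_continuous,
    (hP.isStripBounded_angularSpeed.eval (bump N)).eventually_continuous]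
    with n h2 h1 hflat hWc hbc
  obtain ⟨hn, ε, hε0, hε1, hflat⟩ := hflat
  rw [dist_zero_right] at h1 ⊢
  have hsplit : ∫ t in (0 : ℝ)..2 * Real.pi, centeredSq n (P n) ((n : ℂ) * t) ^ k
      = (∫ t in (0 : ℝ)..2 * Real.pi, (1 - bump N ^ 2).eval (angularSpeed n (P n) ((n : ℂ) * t)) *
          centeredSq n (P n) ((n : ℂ) * t) ^ k)
        + ∫ t in (0 : ℝ)..2 * Real.pi, (bump N).eval (angularSpeed n (P n) ((n : ℂ) * t)) ^ 2 *
          centeredSq n (P n) ((n : ℂ) * t) ^ k := by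
    rw [← intervalIntegral.integral_add]
    · congr 1
      ext t
      simp only [eval_sub, eval_one, eval_pow]
      ring
    · simp only [eval_sub, eval_one, eval_pow]
      exact ((continuous_const.sub (hbc.pow 2)).mul hWc).intervalIntegrable _ _
    · exact ((hbc.pow 2).mul hWc).intervalIntegrable _ _
  have hbound : ‖∫ t in (0 : ℝ)..2 * Real.pi,
      (bump N).eval (angularSpeed n (P n) ((n : ℂ) * t)) ^ 2 *
        centeredSq n (P n) ((n : ℂ) * t) ^ k‖
      ≤ 4 ^ k * ∫ t in (0 : ℝ)..2 * Real.pi,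
        ‖(bump N).eval (angularSpeed n (P n) ((n : ℂ) * t))‖ ^ 2 := by
    rw [← intervalIntegral.integral_const_mul]
    refine intervalIntegral.norm_integral_le_of_norm_le Real.two_pi_pos.le
      (Eventually.of_forall fun t _ => ?_)
      ((continuous_const.mul (hbc.norm.pow 2)).intervalIntegrable _ _)
    have hf := hflat.norm_scaled_le hn hε0 ((n : ℂ) * t)
    have him : ((n : ℂ) * t).im = 0 := by simp
    rw [him, abs_zero, Real.exp_zero, mul_one] at hf
    -- On the real axis |W| = |f|² ≤ (1 + ε)² ≤ 4, the source of the factor 4^k.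
    have hW : ‖centeredSq n (P n) ((n : ℂ) * t)‖ ≤ 4 := by
      rw [norm_centeredSq_ofReal]
      nlinarith [norm_nonneg (scaled n (P n) ((n : ℂ) * t))]
    rw [norm_mul, norm_pow, norm_pow, mul_comm]
    gcongr
  rw [hsplit]
  refine (norm_add_le _ _).trans_lt ?_
  linarith

/-! ### Weyl's criterion -/

theorem integral_exp_intCast_mul_I {k : ℤ} (hk : k ≠ 0) :
    ∫ t in (0 : ℝ)..2 * Real.pi, exp (k * I * t) = 0 := by
  have hc : (k : ℂ) * I ≠ 0 := mul_ne_zero (by exact_mod_cast hk) I_ne_zero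
  rw [integral_exp_mul_complex hc]
  have : exp ((k : ℂ) * I * (2 * Real.pi : ℝ)) = 1 := by
    rw [exp_eq_one_iff]
    refine ⟨k, ?_⟩
    push_cast
    ring
  rw [this]
  simp

/-- Weyl's criterion in integral form: phases whose Fourier moments tend to zero become uniformly
distributed modulo `2π`. -/
theorem tendsto_integral_comp_of_tendsto_fourier {θ : ℕ → ℝ → ℝ} (hm : ∀ n, Measurable (θ n))
    (hθ : ∀ k : ℤ, k ≠ 0 → Tendsto (fun n : ℕ => ∫ t in (0 : ℝ)..2 * Real.pi,
      exp (k * I * θ n t)) atTop (𝓝 0))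
    {G : ℝ → ℂ} (hG : Continuous G) (hper : Function.Periodic G (2 * Real.pi)) :
    Tendsto (fun n : ℕ => ∫ t in (0 : ℝ)..2 * Real.pi, G (θ n t)) atTop
      (𝓝 (∫ t in (0 : ℝ)..2 * Real.pi, G t)) := by
  have hpi : Fact (0 < 2 * Real.pi) := ⟨Real.two_pi_pos⟩
  have hint : ∀ (g : C(AddCircle (2 * Real.pi), ℂ)) (φ : ℝ → ℝ), Measurable φ →
      IntervalIntegrable (fun t => g (φ t : AddCircle (2 * Real.pi))) volume 0 (2 * Real.pi) := by
    intro g φ hφ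
    refine (intervalIntegrable_const (c := ‖g‖)).mono_fun' ?_
      (Eventually.of_forall fun t => g.norm_coe_le_norm _)
    have : Measurable fun x : ℝ => g (x : AddCircle (2 * Real.pi)) :=
      (g.continuous.comp (AddCircle.continuous_mk' _)).measurable
    exact (this.comp hφ).aestronglyMeasurable
  have hspan : ∀ g ∈ Submodule.span ℂ (Set.range (fourier (T := 2 * Real.pi))),
      Tendsto (fun n : ℕ => ∫ t in (0 : ℝ)..2 * Real.pi, g (θ n t : AddCircle (2 * Real.pi))) atTop
        (𝓝 (∫ t in (0 : ℝ)..2 * Real.pi, g (t : AddCircle (2 * Real.pi)))) := by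
    intro g hg
    induction hg using Submodule.span_induction with
    | mem g hg =>
      obtain ⟨k, rfl⟩ := hg
      have e : ∀ x : ℝ, fourier k (x : AddCircle (2 * Real.pi)) = exp (k * I * x) := by
        intro x
        rw [fourier_coe_apply]
        congr 1
        have : (Real.pi : ℂ) ≠ 0 := by exact_mod_cast Real.pi_ne_zero
        push_cast
        field_simp
      simp only [e]
      by_cases hk : k = 0
      · subst hk
        simp
      · rw [integral_exp_intCast_mul_I hk]
        exact hθ k hk
    | zero => simp
    | add g g' _ _ h h' =>
      simp only [ContinuousMap.add_apply]
      rw [intervalIntegral.integral_add (hint g (fun t => t) measurable_id)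
        (hint g' (fun t => t) measurable_id)]
      simp only [intervalIntegral.integral_add (hint g _ (hm _)) (hint g' _ (hm _))]
      exact h.add h'
    | smul a g _ h =>
      simp only [ContinuousMap.smul_apply, smul_eq_mul, intervalIntegral.integral_const_mul]
      exact h.const_mul a
  let g : C(AddCircle (2 * Real.pi), ℂ) := ⟨hper.lift, continuous_coinduced_dom.mpr hG⟩
  have hg : ∀ x : ℝ, g (x : AddCircle (2 * Real.pi)) = G x := fun x => hper.lift_coe x
  rw [Metric.tendsto_nhds]
  intro c hc
  have hpos := Real.two_pi_pos
  have hmem : g ∈ closure (Submodule.span ℂ (Set.range (fourier (T := 2 * Real.pi))) :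
      Set C(AddCircle (2 * Real.pi), ℂ)) := by
    rw [← Submodule.topologicalClosure_coe, span_fourier_closure_eq_top]
    trivial
  -- With this tolerance each replacement of G by the trigonometric polynomial costs at most c/4;
  -- the three errors sum to less than c.
  obtain ⟨g', hg', hdist⟩ := Metric.mem_closure_iff.mp hmem (c / (4 * (2 * Real.pi))) (by positivity)
  have happrox : ∀ φ : ℝ → ℝ, Measurable φ →
      ‖(∫ t in (0 : ℝ)..2 * Real.pi, G (φ t)) -
        ∫ t in (0 : ℝ)..2 * Real.pi, g' (φ t : AddCircle (2 * Real.pi))‖ ≤ c / 4 := by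
    intro φ hφ
    simp only [← hg]
    rw [← intervalIntegral.integral_sub (hint g φ hφ) (hint g' φ hφ)]
    refine (intervalIntegral.norm_integral_le_of_norm_le_const
      (C := c / (4 * (2 * Real.pi))) fun t _ => ?_).trans (le_of_eq ?_)
    · rw [← dist_eq_norm]
      exact (ContinuousMap.dist_apply_le_dist _).trans hdist.le
    · rw [sub_zero, abs_of_pos hpos]
      field_simp
  filter_upwards [(Metric.tendsto_nhds.mp (hspan g' hg')) (c / 4) (by positivity)] with n hn
  have h1 := happrox (θ n) (hm n)
  have h2 := happrox id measurable_id
  rw [dist_eq_norm] at hn ⊢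
  rw [norm_sub_rev] at h2
  simp only [id] at h2
  have h3 := norm_add₃_le (a := (∫ t in (0 : ℝ)..2 * Real.pi, G (θ n t)) -
        ∫ t in (0 : ℝ)..2 * Real.pi, g' (θ n t : AddCircle (2 * Real.pi)))
      (b := (∫ t in (0 : ℝ)..2 * Real.pi, g' (θ n t : AddCircle (2 * Real.pi))) -
        ∫ t in (0 : ℝ)..2 * Real.pi, g' (t : AddCircle (2 * Real.pi)))
      (c := (∫ t in (0 : ℝ)..2 * Real.pi, g' (t : AddCircle (2 * Real.pi))) -
        ∫ t in (0 : ℝ)..2 * Real.pi, G t)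
  rw [sub_add_sub_cancel, sub_add_sub_cancel] at h3
  linarith

/-! ### The mean of |sin|^q -/

/-- Integrate |y|^q e^{−x²−y²} over the plane twice: Cartesian coordinates give √π Γ((q+1)/2), and
polar coordinates give Γ(q/2+1)/2 times the required integral. -/
theorem integral_abs_sin_rpow {q : ℝ} (hq : 0 < q) :
    ∫ x in -Real.pi..Real.pi, |Real.sin x| ^ q
      = 2 * Real.pi * (Real.Gamma ((q + 1) / 2) / (Real.Gamma (q / 2 + 1) * Real.sqrt Real.pi)) := by
  have hpolar := integral_comp_polarCoord_symm
    (fun p : ℝ × ℝ => Real.exp (-1 * p.1 ^ 2) * (|p.2| ^ q * Real.exp (-1 * |p.2| ^ (2 : ℝ))))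
  have hL : ∫ p in polarCoord.target, p.1 • (fun p : ℝ × ℝ => Real.exp (-1 * p.1 ^ 2) *
      (|p.2| ^ q * Real.exp (-1 * |p.2| ^ (2 : ℝ)))) (polarCoord.symm p)
      = (∫ r in Set.Ioi (0 : ℝ), r ^ (q + 1) * Real.exp (-1 * r ^ (2 : ℝ))) *
        ∫ x in Set.Ioo (-Real.pi) Real.pi, |Real.sin x| ^ q := by
    rw [polarCoord_target, Measure.volume_eq_prod, ← setIntegral_prod_mul]
    refine setIntegral_congr_fun (measurableSet_Ioi.prod measurableSet_Ioo) fun p hp => ?_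
    have hr : 0 < p.1 := hp.1
    simp only [polarCoord_symm_apply, smul_eq_mul, Real.rpow_two, abs_mul, abs_of_pos hr]
    rw [Real.mul_rpow hr.le (abs_nonneg _), Real.rpow_add hr, Real.rpow_one]
    have : Real.exp (-1 * p.1 ^ 2) = Real.exp (-1 * (p.1 * Real.cos p.2) ^ 2) *
        Real.exp (-1 * (p.1 * |Real.sin p.2|) ^ 2) := by
      rw [← Real.exp_add]
      congr 1
      rw [mul_pow, mul_pow, sq_abs]
      linear_combination (p.1 ^ 2) * (Real.sin_sq_add_cos_sq p.2)
    rw [this]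
    ring
  have hR : ∫ p : ℝ × ℝ, Real.exp (-1 * p.1 ^ 2) *
      (|p.2| ^ q * Real.exp (-1 * |p.2| ^ (2 : ℝ)))
      = Real.sqrt Real.pi * (2 * ∫ y in Set.Ioi (0 : ℝ), y ^ q * Real.exp (-1 * y ^ (2 : ℝ))) := by
    rw [Measure.volume_eq_prod, integral_prod_mul (fun x : ℝ => Real.exp (-1 * x ^ 2))
      (fun y : ℝ => |y| ^ q * Real.exp (-1 * |y| ^ (2 : ℝ))), integral_gaussian, div_one,
      integral_comp_abs (f := fun y : ℝ => y ^ q * Real.exp (-1 * y ^ (2 : ℝ)))]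
  rw [hL, hR, _root_.integral_rpow_mul_exp_neg_mul_rpow two_pos (by linarith) one_pos,
    _root_.integral_rpow_mul_exp_neg_mul_rpow two_pos (by linarith) one_pos, Real.one_rpow,
    Real.one_rpow, ← integral_Ioc_eq_integral_Ioo,
    ← intervalIntegral.integral_of_le (by linarith [Real.pi_pos])] at hpolar
  have e : (q + 1 + 1) / 2 = q / 2 + 1 := by ring
  rw [e] at hpolar
  have hG : Real.Gamma (q / 2 + 1) ≠ 0 := (Real.Gamma_pos_of_pos (by positivity)).ne'
  have hs : Real.sqrt Real.pi ≠ 0 := (Real.sqrt_pos.mpr Real.pi_pos).ne'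
  have hs2 := Real.sq_sqrt Real.pi_pos.le
  field_simp at hpolar ⊢
  linear_combination Real.sqrt Real.pi * hpolar + 2 * Real.Gamma ((q + 1) / 2) * hs2

theorem continuous_abs_sin_rpow {q : ℝ} (hq : 0 < q) :
    Continuous fun x : ℝ => |Real.sin x| ^ q :=
  Real.continuous_sin.abs.rpow_const fun _ => Or.inr hq.le

theorem integral_abs_sin_half_rpow {q : ℝ} (hq : 0 < q) :
    ∫ x in (0 : ℝ)..2 * Real.pi, |Real.sin (x / 2)| ^ q
      = 2 * Real.pi * (Real.Gamma ((q + 1) / 2) / (Real.Gamma (q / 2 + 1) * Real.sqrt Real.pi)) := by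
  have hper : Function.Periodic (fun x : ℝ => |Real.sin x| ^ q) Real.pi := fun x => by
    simp [Real.sin_add_pi]
  have hint := fun a b => (continuous_abs_sin_rpow hq).intervalIntegrable (μ := volume) a b
  have h1 := hper.intervalIntegral_add_eq (-Real.pi) 0
  rw [neg_add_cancel, zero_add] at h1
  rw [← integral_abs_sin_rpow hq, ← intervalIntegral.integral_add_adjacent_intervals
    (hint (-Real.pi) 0) (hint 0 Real.pi), h1,
    intervalIntegral.integral_comp_div (fun x : ℝ => |Real.sin x| ^ q) two_ne_zero, zero_div,
    mul_div_cancel_left₀ _ (two_ne_zero (α := ℝ)), smul_eq_mul]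
  ring

/-! ### Equidistribution of the phase and the q-th mean -/

theorem scaledConj_natCast_mul_ofReal (n : ℕ) (p : ℂ[X]) (t : ℝ) :
    scaledConj n p ((n : ℂ) * t) = conj (scaled n p ((n : ℂ) * t)) := by
  simp [scaledConj]

theorem continuous_centeredSq (n : ℕ) (p : ℂ[X]) :
    Continuous fun t : ℝ => centeredSq n p ((n : ℂ) * t) := by
  have := (differentiable_scaled n p).continuous
  unfold centeredSq
  fun_prop

theorem IsUltraflat.eventually_abs_norm_centeredSq_pow_sub_one_le (hP : IsUltraflat P) (j : ℕ)
    {c : ℝ} (hc : 0 < c) :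
    ∀ᶠ n in atTop, ∀ t : ℝ, |‖centeredSq n (P n) ((n : ℂ) * t)‖ ^ j - 1| ≤ c := by
  have h := hP.isStripSmall_mul_sub_one.pow_sub_pow
    (hP.isStripBounded_scaled.mul hP.isStripBounded_scaledConj) (isStripBounded_const 1) j
  filter_upwards [h 1 c hc] with n hn t
  have h2 := hn.2 _ (natCast_mul_ofReal_mem_strip n t)
  rw [scaledConj_natCast_mul_ofReal, mul_conj, normSq_eq_norm_sq, ← norm_centeredSq_ofReal,
    one_pow, ← ofReal_pow, ← ofReal_one, ← ofReal_sub, norm_real] at h2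
  exact h2

/-- Replacing W^j by its phase changes the integrand by | 1 − |W|^j |, which is uniformly small. -/
theorem IsUltraflat.tendsto_integral_exp_arg_nat (hP : IsUltraflat P) {j : ℕ} (hj : j ≠ 0) :
    Tendsto (fun n : ℕ => ∫ t in (0 : ℝ)..2 * Real.pi,
      exp (j * I * arg (centeredSq n (P n) ((n : ℂ) * t)))) atTop (𝓝 0) := by
  have hW := hP.tendsto_integral_centeredSq_pow hj
  suffices hdiff : Tendsto (fun n : ℕ => ∫ t in (0 : ℝ)..2 * Real.pi,
      (exp (j * I * arg (centeredSq n (P n) ((n : ℂ) * t))) -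
        centeredSq n (P n) ((n : ℂ) * t) ^ j)) atTop (𝓝 0) by
    have hsum := hdiff.add hW
    rw [add_zero] at hsum
    refine hsum.congr fun n => ?_
    have hc : IntervalIntegrable (fun t : ℝ => centeredSq n (P n) ((n : ℂ) * t) ^ j) volume 0
      (2 * Real.pi) := ((continuous_centeredSq n (P n)).pow j).intervalIntegrable _ _
    have he : IntervalIntegrable (fun t : ℝ =>
        exp (j * I * arg (centeredSq n (P n) ((n : ℂ) * t)))) volume 0 (2 * Real.pi) := by
      refine (intervalIntegrable_const (c := (1 : ℝ))).mono_fun' ?_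
        (Eventually.of_forall fun t => ?_)
      · have := (continuous_centeredSq n (P n)).measurable
        exact Measurable.aestronglyMeasurable (by fun_prop)
      · have : (j : ℂ) * I * arg (centeredSq n (P n) ((n : ℂ) * t))
            = ((j * arg (centeredSq n (P n) ((n : ℂ) * t)) : ℝ) : ℂ) * I := by
          push_cast
          ring
        dsimp only
        rw [this, norm_exp_ofReal_mul_I]
    rw [← intervalIntegral.integral_add (he.sub hc) hc]
    simp
  rw [Metric.tendsto_nhds]
  intro c hc
  have hpi := Real.pi_pos
  filter_upwards [hP.eventually_abs_norm_centeredSq_pow_sub_one_le j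
    (c := c / (4 * Real.pi)) (by positivity)] with n hn
  rw [dist_zero_right]
  refine (intervalIntegral.norm_integral_le_of_norm_le_const
    (C := c / (4 * Real.pi)) fun t _ => ?_).trans_lt ?_
  · set w := centeredSq n (P n) ((n : ℂ) * t) with hw
    have e : exp (j * I * arg w) - w ^ j
        = ((1 - ‖w‖ ^ j : ℝ) : ℂ) * exp (((j * arg w : ℝ) : ℂ) * I) := by
      have h1 : w ^ j = (‖w‖ : ℂ) ^ j * exp (((j * arg w : ℝ) : ℂ) * I) := by
        conv_lhs => rw [← norm_mul_exp_arg_mul_I w]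
        rw [mul_pow, ← exp_nat_mul]
        push_cast
        ring_nf
      rw [h1]
      push_cast
      ring_nf
    rw [e, norm_mul, norm_exp_ofReal_mul_I, mul_one, norm_real, Real.norm_eq_abs, abs_sub_comm]
    exact hn t
  · rw [sub_zero, abs_of_pos (by positivity)]
    field_simp
    linarith

theorem IsUltraflat.tendsto_integral_exp_arg (hP : IsUltraflat P) {k : ℤ} (hk : k ≠ 0) :
    Tendsto (fun n : ℕ => ∫ t in (0 : ℝ)..2 * Real.pi,
      exp (k * I * arg (centeredSq n (P n) ((n : ℂ) * t)))) atTop (𝓝 0) := by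
  obtain ⟨j, rfl | rfl⟩ := k.eq_nat_or_neg
  · exact_mod_cast hP.tendsto_integral_exp_arg_nat (j := j) (by simpa using hk)
  · have h := (continuous_conj.tendsto _).comp
      (hP.tendsto_integral_exp_arg_nat (j := j) (by simpa using hk))
    rw [map_zero] at h
    refine h.congr fun n => ?_
    rw [Function.comp_apply, intervalIntegral.integral_of_le Real.two_pi_pos.le,
      intervalIntegral.integral_of_le Real.two_pi_pos.le, ← integral_conj]
    congr 1
    ext t
    rw [← exp_conj]
    simp

/-- With w = ū a², the squared modulus is 2|a|² − 2 Re w = 2|a|²(1 − cos arg w), and the half-angle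
formula finishes. -/
theorem norm_sub_mul_conj {a u : ℂ} (hu : ‖u‖ = 1) :
    ‖a - u * conj a‖ = 2 * ‖a‖ * |Real.sin (arg (conj u * a ^ 2) / 2)| := by
  set w := conj u * a ^ 2 with hw
  have hwn : ‖w‖ = ‖a‖ ^ 2 := by simp [hw, hu]
  have hre : ‖a‖ ^ 2 * Real.cos (arg w) = w.re := by rw [← hwn, norm_mul_cos_arg]
  have hcos : Real.cos (arg w) = 1 - 2 * Real.sin (arg w / 2) ^ 2 := by
    have := Real.cos_two_mul (arg w / 2)
    rw [mul_div_cancel₀ _ two_ne_zero] at this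
    rw [this, Real.cos_sq']
    ring
  have hsq : ‖a - u * conj a‖ ^ 2 = 2 * ‖a‖ ^ 2 - 2 * w.re := by
    rw [← normSq_eq_norm_sq, normSq_sub, normSq_eq_norm_sq, normSq_eq_norm_sq]
    have : a * conj (u * conj a) = w := by
      rw [hw, map_mul, conj_conj]
      ring
    rw [this, norm_mul, hu, norm_conj]
    ring
  refine (sq_eq_sq₀ (norm_nonneg _) (by positivity)).mp ?_
  rw [hsq, ← hre, hcos, mul_pow, mul_pow, sq_abs]
  ring

/-- On the circle p*(z) = zⁿ times the conjugate of p(z), so the preceding identity applies with u =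
zⁿ, and ū a² becomes W at s = nt. -/
theorem norm_circleEval_sub_conjReciprocal {n : ℕ} (hn : 1 ≤ n) {p : ℂ[X]} (hp : p.natDegree ≤ n)
    (t : ℝ) :
    ‖circleEval (p - conjReciprocal n p) t‖
      = Real.sqrt ((n : ℝ) + 1) * (2 * ‖scaled n p ((n : ℂ) * t)‖ *
        |Real.sin (arg (centeredSq n p ((n : ℂ) * t)) / 2)|) := by
  have hn0 : (n : ℂ) ≠ 0 := Nat.cast_ne_zero.mpr (by omega)
  have hs : (Real.sqrt ((n : ℝ) + 1) : ℂ) ≠ 0 := by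
    exact_mod_cast (Real.sqrt_pos.mpr (by positivity)).ne'
  set z := exp (t * I) with hz
  have hz1 : ‖z‖ = 1 := norm_exp_ofReal_mul_I t
  have hzc : (conj z)⁻¹ = z := by
    rw [inv_eq_of_mul_eq_one_right]
    rw [← normSq_eq_conj_mul_self, normSq_eq_norm_sq, hz1]
    simp
  have hscaled : p.eval z = Real.sqrt ((n : ℝ) + 1) * scaled n p ((n : ℂ) * t) := by
    have : (n : ℂ) * t * I / n = t * I := by field_simp
    rw [scaled, this, mul_div_cancel₀ _ hs]
  have hcent : centeredSq n p ((n : ℂ) * t) = conj (z ^ n) * scaled n p ((n : ℂ) * t) ^ 2 := by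
    rw [centeredSq, hz, ← exp_nat_mul, ← exp_conj]
    congr 2
    simp
    ring
  have hmain : circleEval (p - conjReciprocal n p) t = Real.sqrt ((n : ℝ) + 1) *
      (scaled n p ((n : ℂ) * t) - z ^ n * conj (scaled n p ((n : ℂ) * t))) := by
    rw [circleEval, ← hz, eval_sub, conjReciprocal_eval n hp (exp_ne_zero _), hzc, hscaled, map_mul,
      conj_ofReal]
    ring
  rw [hmain, norm_mul, norm_sub_mul_conj (by rw [norm_pow, hz1, one_pow]), hcent, norm_real,
    Real.norm_of_nonneg (Real.sqrt_nonneg _)]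

theorem IsUltraflat.eventually_abs_norm_scaled_rpow_sub_one_le (hP : IsUltraflat P) (q : ℝ)
    {c : ℝ} (hc : 0 < c) :
    ∀ᶠ n in atTop, ∀ t : ℝ, |‖scaled n (P n) ((n : ℂ) * t)‖ ^ q - 1| ≤ c := by
  have hcont : ContinuousAt (fun x : ℝ => x ^ (q / 2)) 1 :=
    Real.continuousAt_rpow_const 1 (q / 2) (Or.inl one_ne_zero)
  obtain ⟨δ, hδ, hδc⟩ := Metric.continuousAt_iff.mp hcont c hc
  filter_upwards [hP.eventually_abs_norm_centeredSq_pow_sub_one_le 1 (half_pos hδ)] with n hn t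
  have h := hn t
  rw [pow_one, norm_centeredSq_ofReal] at h
  have h2 := hδc (x := ‖scaled n (P n) ((n : ℂ) * t)‖ ^ 2) (by
    rw [Real.dist_eq]
    linarith)
  rw [Real.one_rpow, Real.dist_eq, ← Real.rpow_natCast, ← Real.rpow_mul (norm_nonneg _)] at h2
  have e : ((2 : ℕ) : ℝ) * (q / 2) = q := by
    push_cast
    ring
  rw [e] at h2
  exact h2.le

theorem IsUltraflat.tendsto_integral_abs_sin_arg_rpow (hP : IsUltraflat P) {q : ℝ} (hq : 0 < q) :
    Tendsto (fun n : ℕ => ∫ t in (0 : ℝ)..2 * Real.pi,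
      |Real.sin (arg (centeredSq n (P n) ((n : ℂ) * t)) / 2)| ^ q) atTop
      (𝓝 (∫ t in (0 : ℝ)..2 * Real.pi, |Real.sin (t / 2)| ^ q)) := by
  have hG : Continuous fun x : ℝ => ((|Real.sin (x / 2)| ^ q : ℝ) : ℂ) :=
    continuous_ofReal.comp ((continuous_abs_sin_rpow hq).comp (continuous_id.div_const 2))
  -- sin(x/2) only changes sign under x ↦ x + 2π; the absolute value restores periodicity.
  have hper : Function.Periodic (fun x : ℝ => ((|Real.sin (x / 2)| ^ q : ℝ) : ℂ))
      (2 * Real.pi) := by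
    intro x
    have : (x + 2 * Real.pi) / 2 = x / 2 + Real.pi := by ring
    simp only [this, Real.sin_add_pi, abs_neg]
  have h := tendsto_integral_comp_of_tendsto_fourier
    (θ := fun n t => arg (centeredSq n (P n) ((n : ℂ) * t)))
    (fun n => measurable_arg.comp (continuous_centeredSq n (P n)).measurable)
    (fun k hk => hP.tendsto_integral_exp_arg hk) hG hper
  simp only [intervalIntegral.integral_ofReal] at h
  exact tendsto_ofReal_iff.mp h

theorem IsUltraflat.tendsto_integral_norm_rpow_mul_abs_sin_arg_rpow (hP : IsUltraflat P) {q : ℝ}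
    (hq : 0 < q) :
    Tendsto (fun n : ℕ => ∫ t in (0 : ℝ)..2 * Real.pi, ‖scaled n (P n) ((n : ℂ) * t)‖ ^ q *
      |Real.sin (arg (centeredSq n (P n) ((n : ℂ) * t)) / 2)| ^ q) atTop
      (𝓝 (∫ t in (0 : ℝ)..2 * Real.pi, |Real.sin (t / 2)| ^ q)) := by
  have hbound : ∀ n (t : ℝ),
      |Real.sin (arg (centeredSq n (P n) ((n : ℂ) * t)) / 2)| ^ q ≤ 1 := fun n t =>
    Real.rpow_le_one (abs_nonneg _) (Real.abs_sin_le_one _) hq.le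
  have hsin : ∀ n, Measurable fun t : ℝ =>
      |Real.sin (arg (centeredSq n (P n) ((n : ℂ) * t)) / 2)| ^ q := fun n =>
    ((continuous_abs_sin_rpow hq).comp (continuous_id.div_const 2)).measurable.comp
      (measurable_arg.comp (continuous_centeredSq n (P n)).measurable)
  have hsinInt : ∀ n, IntervalIntegrable (fun t : ℝ =>
      |Real.sin (arg (centeredSq n (P n) ((n : ℂ) * t)) / 2)| ^ q) volume 0 (2 * Real.pi) := by
    intro n
    refine (intervalIntegrable_const (c := (1 : ℝ))).mono_fun' (hsin n).aestronglyMeasurable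
      (Eventually.of_forall fun t => ?_)
    dsimp only
    rw [Real.norm_of_nonneg (Real.rpow_nonneg (abs_nonneg _) _)]
    exact hbound n t
  have hcont : ∀ n, Continuous fun t : ℝ => ‖scaled n (P n) ((n : ℂ) * t)‖ ^ q := fun n =>
    ((differentiable_scaled n (P n)).continuous.comp (by fun_prop)).norm.rpow_const
      fun _ => Or.inr hq.le
  suffices hdiff : Tendsto (fun n : ℕ => ∫ t in (0 : ℝ)..2 * Real.pi,
      (‖scaled n (P n) ((n : ℂ) * t)‖ ^ q - 1) *
        |Real.sin (arg (centeredSq n (P n) ((n : ℂ) * t)) / 2)| ^ q) atTop (𝓝 0) by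
    have hsum := hdiff.add (hP.tendsto_integral_abs_sin_arg_rpow hq)
    rw [zero_add] at hsum
    refine hsum.congr fun n => ?_
    have hc : Continuous fun t : ℝ => ‖scaled n (P n) ((n : ℂ) * t)‖ ^ q - 1 :=
      (hcont n).sub continuous_const
    rw [← intervalIntegral.integral_add ((hsinInt n).continuousOn_mul hc.continuousOn) (hsinInt n)]
    congr 1
    ext t
    ring
  rw [Metric.tendsto_nhds]
  intro c hc
  have hpi := Real.pi_pos
  filter_upwards [hP.eventually_abs_norm_scaled_rpow_sub_one_le q
    (c := c / (4 * Real.pi)) (by positivity)] with n hn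
  rw [dist_zero_right]
  refine (intervalIntegral.norm_integral_le_of_norm_le_const
    (C := c / (4 * Real.pi)) fun t _ => ?_).trans_lt ?_
  · rw [norm_mul, Real.norm_eq_abs, Real.norm_of_nonneg (Real.rpow_nonneg (abs_nonneg _) _)]
    exact (mul_le_of_le_one_right (abs_nonneg _) (hbound n t)).trans (hn t)
  · rw [sub_zero, abs_of_pos (by positivity)]
    field_simp
    linarith

theorem norm_circleEval_sub_conjReciprocal_rpow {n : ℕ} (hn : 1 ≤ n) {p : ℂ[X]}
    (hp : p.natDegree ≤ n) (q t : ℝ) :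
    ‖circleEval (p - conjReciprocal n p) t‖ ^ q
      = 2 ^ q * ((n : ℝ) + 1) ^ (q / 2) * (‖scaled n p ((n : ℂ) * t)‖ ^ q *
        |Real.sin (arg (centeredSq n p ((n : ℂ) * t)) / 2)| ^ q) := by
  rw [norm_circleEval_sub_conjReciprocal hn hp, Real.mul_rpow (by positivity) (by positivity),
    Real.mul_rpow (by positivity) (by positivity), Real.mul_rpow (by positivity) (by positivity),
    Real.sqrt_eq_rpow, ← Real.rpow_mul (by positivity), one_div_mul_eq_div]
  ring

theorem tendsto_succ_rpow_div_rpow (r : ℝ) :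
    Tendsto (fun n : ℕ => ((n : ℝ) + 1) ^ r / (n : ℝ) ^ r) atTop (𝓝 1) := by
  have h1 : Tendsto (fun n : ℕ => 1 + 1 / (n : ℝ)) atTop (𝓝 1) := by
    simpa using tendsto_one_div_atTop_nhds_zero_nat.const_add (1 : ℝ)
  have h2 := h1.rpow_const (p := r) (Or.inl one_ne_zero)
  rw [Real.one_rpow] at h2
  refine h2.congr' ?_
  filter_upwards [eventually_ge_atTop 1] with n hn
  have hn0 : (0 : ℝ) < n := by exact_mod_cast hn
  rw [← Real.div_rpow (by positivity) hn0.le, add_div, div_self hn0.ne']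

end Ultraflat

theorem theorem2p1 (P : ℕ → Polynomial ℂ) (hP : Ultraflat.IsUltraflat P)
    (q : ℝ) (hq : 0 < q) :
    Filter.Tendsto
      (fun n : ℕ =>
        ((1 / (2 * Real.pi)) *
            ∫ t in (0 : ℝ)..(2 * Real.pi),
              ‖Ultraflat.circleEval (P n - Ultraflat.conjReciprocal n (P n)) t‖ ^ q) /
          ((2 : ℝ) ^ q * Real.Gamma ((q + 1) / 2) /
              (Real.Gamma (q / 2 + 1) * Real.sqrt Real.pi) * (n : ℝ) ^ (q / 2)))
      Filter.atTop (nhds 1) := by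
  have hG1 : Real.Gamma ((q + 1) / 2) ≠ 0 := (Real.Gamma_pos_of_pos (by positivity)).ne'
  have hG2 : Real.Gamma (q / 2 + 1) ≠ 0 := (Real.Gamma_pos_of_pos (by positivity)).ne'
  have hs : Real.sqrt Real.pi ≠ 0 := (Real.sqrt_pos.mpr Real.pi_pos).ne'
  have hpi := Real.pi_ne_zero
  set S := 2 * Real.pi * (Real.Gamma ((q + 1) / 2) / (Real.Gamma (q / 2 + 1) * Real.sqrt Real.pi))
    with hS
  have hS0 : S ≠ 0 := by positivity
  -- The exact prefactor contains (n+1)^{q/2}; the second factor accounts for its ratio to n^{q/2}.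
  have h := ((hP.tendsto_integral_norm_rpow_mul_abs_sin_arg_rpow hq).div_const S).mul
    (Ultraflat.tendsto_succ_rpow_div_rpow (q / 2))
  rw [Ultraflat.integral_abs_sin_half_rpow hq, ← hS, div_self hS0, one_mul] at h
  refine h.congr' ?_
  filter_upwards [hP.eventually_isFlat one_pos] with n ⟨hn, ε, _, _, hflat⟩
  have hn0 : (0 : ℝ) < n := by exact_mod_cast hn
  have hnq : (n : ℝ) ^ (q / 2) ≠ 0 := (Real.rpow_pos_of_pos hn0 _).ne'
  have h2q : (2 : ℝ) ^ q ≠ 0 := (Real.rpow_pos_of_pos two_pos _).ne'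
  simp only [Ultraflat.norm_circleEval_sub_conjReciprocal_rpow hn
    (Ultraflat.unimodular.natDegree_le hflat.1), intervalIntegral.integral_const_mul]
  rw [hS]
  field_simp
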